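/- Let $\tau\in(0,1)$, $\Theta=[a,b]$ with $a<b$, $|\Theta|=b-a$, $\phi(\theta,q)=\theta+\frac{1}{1-\tau}(q-\theta)^+$. Let $Q$ and $Q_l$ ($l\in\mathbb N_0$) be real random variables on a probability space such that, for $\theta\in\Theta$, $\phi(\theta,Q)$ is integrable and all $\phi(\theta,Q_l)$ are square integrable, and suppose that $\Phi(\theta)=\mathbb E[\phi(\theta,Q)]$ is in $C^4(\Theta)$. For $n\ge4$ let $\theta_1<\dots<\theta_n$ be the $n$ equally spaced nodes with $\theta_1=a$, $\theta_n=b$, and let $\mathcal S_n$ be the operator that maps $x\in\mathbb R^n$ to the cubic spline interpolating $x$ at these nodes, with not-a-knot end conditions. With the convention $\phi(\cdot,Q_{-1})=0$ put $$b_l=\max_j|\Phi(\theta_j)-\mathbb E[\phi(\theta_j,Q_l)]|,\qquad V_l=\mathbb E\big[\max_j|\phi(\theta_j,Q_l)-\phi(\theta_j,Q_{l-1})|^2\big]$$ (both depend on $n$). Let $(Q_l^{(i,l)},Q_{l-1}^{(i,l)})$, $l\ge0$, $i\ge1$, be independent with the law of $(Q_l,Q_{l-1})$, and define, for given $n$,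 $L$, $N_0,\dots,N_L$, $$\hat\Phi_L(\theta_j)=\sum_{l=0}^L\frac1{N_l}\sum_{i=1}^{N_l}\big[\phi(\theta_j,Q_l^{(i,l)})-\phi(\theta_j,Q_{l-1}^{(i,l)})\big],\qquad \hat\Phi_L^{(m)}=\frac{d^m}{d\theta^m}\mathcal S_n\big(\hat\Phi_L(\theta_1),\dots,\hat\Phi_L(\theta_n)\big)$$ (an empty average, $N_l=0$, is zero; the formula below gives $N_l=0$ only if $V_l=0$), $\mathrm{MSE}(\hat\Phi_L^{(m)})=\mathbb E\|\Phi^{(m)}-\hat\Phi_L^{(m)}\|^2_{L^\infty(\Theta)}$ and $\mathrm{Cost}(\hat\Phi_L^{(m)})=\sum_{l=0}^LN_l\mathfrak c_l$, where $\mathfrak c_l>0$ is the cost of one realisation of $(Q_l,Q_{l-1})$. Call positive numbers $C_1(m),C_2(m)$ $(m=0,1,2)$ and $C_3$ spline constants on $\Theta$ if for all $n\ge4$, $m\in\{0,1,2\}$, $f\in C^4(\Theta)$, $x\in\mathbb R^n$, writing $\|\cdot\|$ for the norm of $L^\infty(\Theta)$, $$\|f^{(m)}-(\mathcal S_nf)^{(m)}\|\le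 C_1(m)\|f^{(4)}\|\big(\tfrac{|\Theta|}n\big)^{4-m},\quad \|(\mathcal S_nx)^{(m)}\|\le C_2(m)(n-1)^m\|\mathcal S_nx\|,\quad \|\mathcal S_nx\|\le C_3\max_j|x_j|,$$ where $\mathcal S_nf=\mathcal S_n(f(\theta_1),\dots,f(\theta_n))$. Then spline constants exist, and they can be chosen such that $C_1(m)$, $C_3$ and $|\Theta|^mC_2(m)$ do not depend on $\Theta$. Moreover, for any spline constants on $\Theta$ the following holds. Let $\alpha,\beta,\gamma>0$ with $2\alpha\ge\min(\beta,\gamma)$, and suppose that there are constants $c_\alpha,c_\beta,c_\gamma$ with $$b_l\le c_\alpha e^{-\alpha l},\qquad V_l\le c_\beta e^{-\beta l},\qquad \mathfrak c_l\le c_\gamma e^{\gamma l}$$ for all $l\in\mathbb N_0$ and all numbers of nodes $n\ge4$. Let $m\in\{0,1,2\}$, let $w_i,w_b,w_s>0$ with $w_i+w_b+w_s=1$, and for $\epsilon>0$ put $\epsilon_i=\epsilon\sqrt{w_i/3}$, $\epsilon_b=\epsilon\sqrt{w_b/3}$, $\epsilon_s=\epsilon\sqrt{w_s/3}$, $$n=\max\Big\{4,\Big\lceil\Big[\frac{C_1(m)\|\Phi^{(4)}\|_{L^\infty(\Theta)}}{\epsilon_i}\Big]^{\frac1{4-m}}|\Theta|\Big\rceil\Big\},\qquad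 L=\min\Big\{K\in\mathbb N_0:\ b_K\le\frac{\epsilon_b}{C_2(m)C_3(n-1)^m}\Big\},$$ $$N_l=\Big\lceil\frac{C_2(m)^2C_3^2\,c(n)(n-1)^{2m}}{\epsilon_s^2}\sqrt{\frac{V_l}{\mathfrak c_l}}\sum_{k=0}^L\sqrt{V_k\mathfrak c_k}\Big\rceil,\qquad c(n)=2\pi\Big(\ln(n+1)+\sqrt{8/\pi}\sum_{k=2}^{n+1}k^{-2}(\ln k)^{-1/2}\Big).$$ Then there is a constant $K>0$, independent of $\epsilon$, such that for every $0<\epsilon<e^{-1}$ the estimator with these parameters satisfies $\mathrm{MSE}(\hat\Phi_L^{(m)})\le\epsilon^2$ and $$\mathrm{Cost}(\hat\Phi_L^{(m)})\le K\log(\epsilon^{-1})\,\epsilon^{-2-\frac{2m}{4-m}}\cdot\begin{cases}1,&\beta>\gamma,\\ \log(\epsilon^{-1})^2,&\beta=\gamma,\\ \epsilon^{\frac{\beta-\gamma}{\alpha}\frac4{4-m}},&\beta<\gamma.\end{cases}$$ -/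

import Mathlib

open MeasureTheory ProbabilityTheory Set

noncomputable section

/-! ### Cubic spline interpolation on a uniform grid -/

/-- The `j`-th (`j = 0, …, n - 1`) of the `n` equally spaced nodes of `[a, b]`, the first one
being `a` and the last one `b`. -/
def gridNode (a b : ℝ) (n j : ℕ) : ℝ := a + j * ((b - a) / ((n : ℝ) - 1))

/-- `s` coincides on `[u, v]` with a polynomial of degree at most three. -/
def IsCubicOn (s : ℝ → ℝ) (u v : ℝ) : Prop :=
  ∃ p : Polynomial ℝ, p.natDegree ≤ 3 ∧ ∀ t ∈ Icc u v, s t = p.eval t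

/-- `s` is, on `[a, b]`, the cubic spline interpolant of the values `x` at the `n` uniform nodes:
it is of class `C²`, it is a cubic polynomial between consecutive nodes, it takes the prescribed
values, and it satisfies the not-a-knot end conditions: one cubic polynomial on the
first two subintervals, and one on the last two. For `n ≥ 4` this determines `s` on `[a, b]`. -/
structure IsSplineInterpolant (a b : ℝ) (n : ℕ) (x : Fin n → ℝ) (s : ℝ → ℝ) : Prop where
  contDiffOn : ContDiffOn ℝ 2 s (Icc a b)
  interpolates : ∀ j : Fin n, s (gridNode a b n j) = x j
  cubic : ∀ j : ℕ, j + 1 < n → IsCubicOn s (gridNode a b n j) (gridNode a b n (j + 1))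
  left_end : IsCubicOn s (gridNode a b n 0) (gridNode a b n 2)
  right_end : IsCubicOn s (gridNode a b n (n - 3)) (gridNode a b n (n - 1))

open Classical in
/-- The cubic spline interpolation operator `S_n`. Only the values on `[a, b]` are meaningful. -/
def splineInterp (a b : ℝ) (n : ℕ) (x : Fin n → ℝ) : ℝ → ℝ :=
  if h : ∃ s, IsSplineInterpolant a b n x s then h.choose else 0

/-- The norm of `L^∞([a, b])` (essential supremum of `|g|`), with values in `[0, ∞]`. -/
def supNorm (a b : ℝ) (g : ℝ → ℝ) : ENNReal := eLpNorm g ⊤ (volume.restrict (Icc a b))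

/-- The derivative of order `m` on the interval `[a, b]` (one-sided at the end points). -/
def derivOn (a b : ℝ) (m : ℕ) (g : ℝ → ℝ) : ℝ → ℝ := iteratedDerivWithin m g (Icc a b)

/-- `C₁ m`, `C₂ m` (`m = 0, 1, 2`) and `C₃` are constants of the cubic spline interpolation
operator on `[a, b]`: `C₁` is a constant of the interpolation error estimate for `C⁴` functions,
`C₂` of the inverse inequality, and `C₃` of the stability of the operator in the maximum norm.
The norm on `Fin n → ℝ` is the maximum norm. -/
structure IsSplineConstants (a b : ℝ) (C₁ C₂ : ℕ → ℝ) (C₃ : ℝ) : Prop where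
  pos₁ : ∀ m ≤ 2, 0 < C₁ m
  pos₂ : ∀ m ≤ 2, 0 < C₂ m
  pos₃ : 0 < C₃
  interp_error : ∀ n : ℕ, 4 ≤ n → ∀ f : ℝ → ℝ, ContDiffOn ℝ 4 f (Icc a b) → ∀ m ≤ 2,
    supNorm a b (fun t => derivOn a b m f t -
        derivOn a b m (splineInterp a b n (fun j => f (gridNode a b n j))) t) ≤
      ENNReal.ofReal (C₁ m * ((b - a) / n) ^ (4 - m)) * supNorm a b (derivOn a b 4 f)
  inverse : ∀ n : ℕ, 4 ≤ n → ∀ x : Fin n → ℝ, ∀ m ≤ 2,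
    supNorm a b (derivOn a b m (splineInterp a b n x)) ≤
      ENNReal.ofReal (C₂ m * ((n : ℝ) - 1) ^ m) * supNorm a b (splineInterp a b n x)
  stable : ∀ n : ℕ, 4 ≤ n → ∀ x : Fin n → ℝ,
    supNorm a b (splineInterp a b n x) ≤ ENNReal.ofReal (C₃ * ‖x‖)

/-! ### The parametric expectation, level-wise biases and variances -/

/-- `φ(θ, q) = θ + (q - θ)⁺ / (1 - τ)`. -/
def phi (τ θ q : ℝ) : ℝ := θ + 1 / (1 - τ) * max 0 (q - θ)

/-- The parametric expectation `θ ↦ E[φ(θ, X)]`. -/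
def paramExp {Ω : Type*} [MeasurableSpace Ω] (P : Measure Ω) (τ : ℝ) (X : Ω → ℝ) (θ : ℝ) : ℝ :=
  ∫ ω, phi τ θ (X ω) ∂P

/-- The level-wise increment `φ(θ, Q_l) - φ(θ, Q_{l-1})`, which is `φ(θ, Q_0)` on level `0`. -/
def increment {Ω : Type*} (τ : ℝ) (Q : ℕ → Ω → ℝ) (θ : ℝ) : ℕ → Ω → ℝ
  | 0, ω => phi τ θ (Q 0 ω)
  | l + 1, ω => phi τ θ (Q (l + 1) ω) - phi τ θ (Q l ω)

/-- The level-wise bias `b_l`: the maximum over the `n` nodes of `|Φ - E[φ(·, Q_l)]|`. -/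
def levelBias {Ω : Type*} [MeasurableSpace Ω] (P : Measure Ω) (τ a b : ℝ) (Qex : Ω → ℝ)
    (Q : ℕ → Ω → ℝ) (n l : ℕ) : ℝ :=
  ‖fun j : Fin n => paramExp P τ Qex (gridNode a b n j) - paramExp P τ (Q l) (gridNode a b n j)‖

/-- The level-wise variance `V_l`: the expectation of the squared maximum over the `n` nodes of
`|φ(·, Q_l) - φ(·, Q_{l-1})|`. -/
def levelVar {Ω : Type*} [MeasurableSpace Ω] (P : Measure Ω) (τ a b : ℝ)
    (Q : ℕ → Ω → ℝ) (n l : ℕ) : ℝ :=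
  ∫ ω, ‖fun j : Fin n => increment τ Q (gridNode a b n j) l ω‖ ^ 2 ∂P

/-! ### The multilevel Monte Carlo estimator, its error and its cost -/

/-- The pointwise MLMC estimator at `θ`. `Y l i = (Q_l^{(i,l)}, Q_{l-1}^{(i,l)})` are the samples;
the second component is not used on level `0`. -/
def mlmcPoint {Ω : Type*} (τ : ℝ) (Y : ℕ → ℕ → Ω → ℝ × ℝ) (L : ℕ) (N : ℕ → ℕ) (θ : ℝ)
    (ω : Ω) : ℝ :=
  1 / (N 0 : ℝ) * ∑ i ∈ Finset.range (N 0), phi τ θ (Y 0 i ω).1 +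
  ∑ l ∈ Finset.Icc 1 L, 1 / (N l : ℝ) *
    ∑ i ∈ Finset.range (N l), (phi τ θ (Y l i ω).1 - phi τ θ (Y l i ω).2)

/-- The MLMC estimator of the derivative of order `m`: the derivative of the cubic spline that
interpolates the pointwise estimators. -/
def mlmcDeriv {Ω : Type*} (τ a b : ℝ) (Y : ℕ → ℕ → Ω → ℝ × ℝ) (n L : ℕ) (N : ℕ → ℕ) (m : ℕ)
    (ω : Ω) : ℝ → ℝ :=
  derivOn a b m (splineInterp a b n (fun j => mlmcPoint τ Y L N (gridNode a b n j) ω))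

/-- The mean squared error `E[‖g - ĝ‖²]` of a random function `ĝ`, in the norm of
`L^∞([a, b])`. -/
def mse {Ω : Type*} [MeasurableSpace Ω] (P : Measure Ω) (a b : ℝ) (g : ℝ → ℝ)
    (ghat : Ω → ℝ → ℝ) : ENNReal :=
  ∫⁻ ω, supNorm a b (fun t => g t - ghat ω t) ^ 2 ∂P

/-- The cost of the estimator: `N_l` samples on level `l`, each of cost `cost l`. -/
def mlmcCost (cost : ℕ → ℝ) (L : ℕ) (N : ℕ → ℕ) : ℝ :=
  ∑ l ∈ Finset.range (L + 1), (N l : ℝ) * cost l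

/-! ### The choice of the parameters -/

/-- The constant `c(n)`. -/
def cConst (n : ℕ) : ℝ :=
  2 * Real.pi * (Real.log ((n : ℝ) + 1) +
    Real.sqrt (8 / Real.pi) *
      ∑ k ∈ Finset.Icc 2 (n + 1), ((k : ℝ) ^ 2)⁻¹ * (Real.sqrt (Real.log (k : ℝ)))⁻¹)

/-- The part `√(w ε² / 3)` of the tolerance `ε` that belongs to the weight `w`. -/
def tol (w ε : ℝ) : ℝ := Real.sqrt (w * ε ^ 2 / 3)

/-- The number of nodes, `D` being the norm of the fourth derivative, `C₁` the interpolation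
constant and `εi` the tolerance; a cubic spline of this kind needs four nodes. -/
def numNodes (a b : ℝ) (m : ℕ) (C₁ D εi : ℝ) : ℕ :=
  max 4 ⌈(C₁ * D / εi) ^ (1 / (4 - (m : ℝ))) * (b - a)⌉₊

/-- The maximum level: the smallest `K` whose bias `bias K` is at most
`εb / (C₂ C₃ (n - 1)^m)`. -/
def numLevels (bias : ℕ → ℝ) (m : ℕ) (C₂ C₃ εb : ℝ) (n : ℕ) : ℕ :=
  sInf {K : ℕ | bias K ≤ εb / (C₂ * C₃ * ((n : ℝ) - 1) ^ m)}

/-- The number of samples on level `l`. -/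
def numSamples (V cost : ℕ → ℝ) (m : ℕ) (C₂ C₃ εs : ℝ) (n L l : ℕ) : ℕ :=
  ⌈C₂ ^ 2 * C₃ ^ 2 * cConst n * ((n : ℝ) - 1) ^ (2 * m) / εs ^ 2 * Real.sqrt (V l / cost l) *
    ∑ k ∈ Finset.range (L + 1), Real.sqrt (V k * cost k)⌉₊

/-- The factor of the cost bound that depends on the relation between `β` and `γ`. -/
def rateFactor (α β γ : ℝ) (m : ℕ) (ε : ℝ) : ℝ :=
  if γ < β then 1
  else if β = γ then Real.log ε⁻¹ ^ 2
  else ε ^ ((β - γ) / α * (4 / (4 - (m : ℝ))))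

end

/-!
The two halves of the theorem are a priori estimates for not-a-knot splines and a second moment
bound for maxima of sums of independent random variables; the rest is bookkeeping of powers of `ε`.

**Splines.** Let `h` be the distance of the nodes and `M_j` the second derivative of the spline at
the `j`-th node. Continuity of the first derivative gives
`h² (M_j + 4 M_{j+1} + M_{j+2}) = 6 (x_{j+2} - 2 x_{j+1} + x_j)`. The not-a-knot condition says that
`M_0, M_1, M_2` are in arithmetic progression, which turns the first equation into
`h² M_1 = x_2 - 2 x_1 + x_0`, and likewise at the right end. So `M_1` and `M_{n-2}` are known, the
remaining equations are diagonally dominant, and a maximum principle bounds all `M_j`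
(`abs_le_of_moment_relations`). Applied to the spline itself this yields stability, hence uniqueness
and linearity; existence follows by a dimension count in the space of truncated power splines
(`exists_isSplineInterpolant`). Applied to the differences `f''(θ_j) - M_j` it yields the
interpolation error (`IsSplineInterpolant.error_le`), since all the equations are exact for cubic
polynomials. The inverse inequality is a statement on a single cubic.

**Fluctuations.** The constant `cConst n` is large enough for
`E ‖∑ (X_i - E X_i)‖² ≤ cConst n ∑ E ‖X_i‖²` in the maximum norm of `ℝⁿ`
(`integral_norm_sum_centred_sq_le`), with no centring on the right. Symmetrization would lose
too much here. Instead, `‖x‖²` is replaced by the smooth convex function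
`Ψ(x) = (δ + ∑ x_j^(2k))^(1/k)` with `k = ⌈log n⌉`, which lies below its tangent planes plus
`K ‖y‖²`, where `K = (2k - 1) n^(1/k)`. Summands are added one at a time
(`IsSmoothSquare.integral_add_centred_le`).

**Error and cost.** The error is the sum of an interpolation error, a spline through the biases, and
a spline through the fluctuations (`supNorm_sub_derivOn_splineInterp_le`); the parameters are such
that the mean squares of the three parts are at most `ε_i²`, `ε_b²`, `ε_s²`, whose sum is `ε² / 3`.
For the cost, the minimality of `L` gives `e^{αL} ≲ ε^{-4/(4-m)}`, and `n ≲ ε^{-1/(4-m)}`,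
`cConst n ≲ log ε⁻¹`. The costs from rounding up the sample sizes are dominated because
`2α ≥ min(β, γ)` (`exists_mlmcCost_le`).
-/

/-! ### A smooth approximation of the squared maximum norm -/

/-- A function with second derivative in `[0, 2C]` lies between its tangent and the tangent plus
`C t²`. -/
theorem tangent_bounds_of_second_deriv {g g₁ g₂ : ℝ → ℝ} {C : ℝ}
    (h₁ : ∀ t, HasDerivAt g (g₁ t) t) (h₂ : ∀ t, HasDerivAt g₁ (g₂ t) t)
    (h0 : ∀ t, 0 ≤ g₂ t) (hC : ∀ t, g₂ t ≤ 2 * C) :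
    g 0 + g₁ 0 ≤ g 1 ∧ g 1 ≤ g 0 + g₁ 0 + C := by
  have mono : Monotone g₁ := monotone_of_hasDerivAt_nonneg h₂ h0
  have anti : Monotone fun t => 2 * C * t - g₁ t := by
    refine monotone_of_hasDerivAt_nonneg (f' := fun t => 2 * C - g₂ t) (fun t => ?_)
      (fun t => by simpa using hC t)
    exact (((hasDerivAt_id' t).const_mul (2 * C)).fun_sub (h₂ t)).congr_deriv (by ring)
  constructor
  · have h : ∀ t, HasDerivAt (fun t => g t - g₁ 0 * t) (g₁ t - g₁ 0) t := fun t => by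
      exact ((h₁ t).fun_sub ((hasDerivAt_id' t).const_mul (g₁ 0))).congr_deriv (by ring)
    have : MonotoneOn (fun t => g t - g₁ 0 * t) (Ici 0) := by
      refine monotoneOn_of_deriv_nonneg (convex_Ici 0)
        (fun t _ => (h t).continuousAt.continuousWithinAt)
        (fun t _ => (h t).differentiableAt.differentiableWithinAt) (fun t ht => ?_)
      rw [interior_Ici] at ht
      rw [(h t).deriv]
      exact sub_nonneg.2 (mono (le_of_lt ht))
    have := this (by simp) (by simp) (zero_le_one' ℝ)
    simp at this
    linarith
  · have h : ∀ t, HasDerivAt (fun t => g₁ 0 * t + C * t ^ 2 - g t)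
        (g₁ 0 + 2 * C * t - g₁ t) t := fun t => by
      exact ((((hasDerivAt_id' t).const_mul (g₁ 0)).fun_add
        ((hasDerivAt_pow 2 t).const_mul C)).fun_sub (h₁ t)).congr_deriv (by norm_num; ring)
    have : MonotoneOn (fun t => g₁ 0 * t + C * t ^ 2 - g t) (Ici 0) := by
      refine monotoneOn_of_deriv_nonneg (convex_Ici 0)
        (fun t _ => (h t).continuousAt.continuousWithinAt)
        (fun t _ => (h t).differentiableAt.differentiableWithinAt) (fun t ht => ?_)
      rw [interior_Ici] at ht
      rw [(h t).deriv]
      have := anti (le_of_lt ht)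
      simp at this
      linarith
    have := this (by simp) (by simp) (zero_le_one' ℝ)
    simp at this
    linarith

/-- The function `Ψ` on `ℝ^ι` (maximum norm) has the gradient `G`, is convex, and lies below its
tangent planes plus `K ‖y‖²`: a smooth substitute for the squared norm. -/
structure IsSmoothSquare {ι : Type*} [Fintype ι] (K : ℝ) (Ψ : (ι → ℝ) → ℝ)
    (G : (ι → ℝ) → ι → ℝ) : Prop where
  pos : 0 < K
  nonneg : ∀ x, 0 ≤ Ψ x
  continuous : Continuous Ψ
  continuous_grad : ∀ j, Continuous fun x => G x j
  grad_zero : G 0 = 0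
  tangent_le : ∀ x y, Ψ x + ∑ j, G x j * y j ≤ Ψ (x + y)
  le_tangent : ∀ x y, Ψ (x + y) ≤ Ψ x + ∑ j, G x j * y j + K * ‖y‖ ^ 2

/-- The power mean inequality between the exponents `2k - 2` and `2k`. -/
theorem sum_pow_le_card_mul_rpow {ι : Type*} [Fintype ι] (k : ℕ) (hk : 2 ≤ k) (u : ι → ℝ) :
    ∑ j, u j ^ (2 * k - 2) ≤
      (Fintype.card ι : ℝ) ^ (1 / (k : ℝ)) * (∑ j, u j ^ (2 * k)) ^ (1 - 1 / (k : ℝ)) := by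
  have hk' : (1 : ℝ) < k := by exact_mod_cast hk
  have hpq : (k : ℝ).HolderConjugate (k / (k - 1)) := by
    rw [Real.holderConjugate_iff]
    refine ⟨hk', ?_⟩
    field_simp
    ring
  have := Real.inner_le_Lp_mul_Lq_of_nonneg (Finset.univ : Finset ι) (f := fun _ => 1)
    (g := fun j => u j ^ (2 * k - 2)) hpq (fun _ _ => zero_le_one)
    (fun j _ => (even_two_mul k |>.tsub (even_two)).pow_nonneg _)
  simp only [one_mul, Real.one_rpow, Finset.sum_const, Finset.card_univ, nsmul_eq_mul,
    mul_one] at this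
  convert this using 3
  · refine Finset.sum_congr rfl fun j _ => ?_
    obtain ⟨i, rfl⟩ : ∃ i, k = i + 1 := ⟨k - 1, by omega⟩
    have e1 : u j ^ (2 * (i + 1)) = (u j ^ 2) ^ (i + 1) := by rw [pow_mul]
    have e2 : u j ^ (2 * (i + 1) - 2) = (u j ^ 2) ^ i := by rw [← pow_mul]; congr 1
    have hi : (i : ℝ) ≠ 0 := by
      have : 1 ≤ i := by omega
      positivity
    rw [e1, e2, ← Real.rpow_natCast _ i, ← Real.rpow_natCast _ (i + 1),
      ← Real.rpow_mul (sq_nonneg _)]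
    congr 1
    push_cast
    rw [add_sub_cancel_right]
    field_simp
  · field_simp

/-- The smooth square `x ↦ (δ + ∑ x_j^(2k))^(1/k)`; the summand `δ > 0` keeps it
differentiable at the origin. -/
noncomputable def powSquare {ι : Type*} [Fintype ι] (δ : ℝ) (k : ℕ) (x : ι → ℝ) : ℝ :=
  (δ + ∑ j, x j ^ (2 * k)) ^ (1 / (k : ℝ))

/-- The gradient of `powSquare δ k`. -/
noncomputable def powSquareGrad {ι : Type*} [Fintype ι] (δ : ℝ) (k : ℕ) (x : ι → ℝ) (j : ι) : ℝ :=
  2 * (δ + ∑ i, x i ^ (2 * k)) ^ (1 / (k : ℝ) - 1) * x j ^ (2 * k - 1)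

theorem powSquare_base_pos {ι : Type*} [Fintype ι] {δ : ℝ} (hδ : 0 < δ) (k : ℕ) (x : ι → ℝ) :
    0 < δ + ∑ j, x j ^ (2 * k) :=
  add_pos_of_pos_of_nonneg hδ (Finset.sum_nonneg fun _ _ => (even_two_mul k).pow_nonneg _)

theorem norm_sq_le_powSquare {ι : Type*} [Fintype ι] {δ : ℝ} (hδ : 0 < δ) {k : ℕ} (hk : 2 ≤ k)
    (x : ι → ℝ) : ‖x‖ ^ 2 ≤ powSquare δ k x := by
  have hF := powSquare_base_pos hδ k x
  have h0 : 0 ≤ powSquare δ k x := (Real.rpow_pos_of_pos hF _).le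
  have : ‖x‖ ≤ Real.sqrt (powSquare δ k x) := by
    refine (pi_norm_le_iff_of_nonneg (Real.sqrt_nonneg _)).2 fun j => ?_
    refine Real.le_sqrt_of_sq_le ?_
    rw [Real.norm_eq_abs, sq_abs]
    have e : (x j ^ 2) = ((x j ^ 2) ^ k) ^ (1 / (k : ℝ)) := by
      rw [one_div, Real.pow_rpow_inv_natCast (sq_nonneg _) (by omega)]
    rw [e, powSquare]
    refine Real.rpow_le_rpow (by positivity) ?_ (by positivity)
    rw [← pow_mul]
    have := Finset.single_le_sum (f := fun j => x j ^ (2 * k))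
      (fun _ _ => (even_two_mul k).pow_nonneg _) (Finset.mem_univ j)
    linarith
  calc ‖x‖ ^ 2 ≤ Real.sqrt (powSquare δ k x) ^ 2 := by gcongr
    _ = _ := Real.sq_sqrt h0

theorem isSmoothSquare_powSquare {ι : Type*} [Fintype ι] [Nonempty ι] {δ : ℝ} (hδ : 0 < δ) {k : ℕ}
    (hk : 2 ≤ k) :
    IsSmoothSquare ((2 * k - 1) * (Fintype.card ι : ℝ) ^ (1 / (k : ℝ)))
      (powSquare δ k : (ι → ℝ) → ℝ) (powSquareGrad δ k) := by
  have hk' : (2 : ℝ) ≤ k := by exact_mod_cast hk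
  have hk0 : (k : ℝ) ≠ 0 := by positivity
  have key : ∀ x y : ι → ℝ, powSquare δ k x + ∑ j, powSquareGrad δ k x j * y j ≤
      powSquare δ k (x + y) ∧ powSquare δ k (x + y) ≤ powSquare δ k x +
      ∑ j, powSquareGrad δ k x j * y j +
      (2 * k - 1) * (Fintype.card ι : ℝ) ^ (1 / (k : ℝ)) * ‖y‖ ^ 2 := by
    intro x y
    set u : ℝ → ι → ℝ := fun t j => x j + t * y j with hu
    set F : ℝ → ℝ := fun t => δ + ∑ j, u t j ^ (2 * k) with hF
    set P : ℝ → ℝ := fun t => ∑ j, u t j ^ (2 * k - 1) * y j with hP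
    set R : ℝ → ℝ := fun t => ∑ j, u t j ^ (2 * k - 2) * y j ^ 2 with hR
    have hFpos : ∀ t, 0 < F t := fun t => powSquare_base_pos hδ k (u t)
    have du : ∀ t j, HasDerivAt (fun t => u t j) (y j) t := fun t j => by
      exact (((hasDerivAt_id' t).mul_const (y j)).const_add (x j)).congr_deriv (by ring)
    have dF : ∀ t, HasDerivAt F (2 * k * P t) t := fun t => by
      have := (HasDerivAt.fun_sum (u := Finset.univ) fun j _ =>
        (du t j).fun_pow (2 * k)).const_add δ
      refine this.congr_deriv ?_
      simp only [hP]
      rw [Finset.mul_sum]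
      push_cast
      exact Finset.sum_congr rfl fun j _ => by ring
    have dP : ∀ t, HasDerivAt P ((2 * k - 1) * R t) t := fun t => by
      have := (HasDerivAt.fun_sum (u := Finset.univ) fun j _ =>
        ((du t j).fun_pow (2 * k - 1)).mul_const (y j))
      refine this.congr_deriv ?_
      simp only [hR]
      simp only [Finset.mul_sum]
      refine Finset.sum_congr rfl fun j _ => ?_
      rw [Nat.cast_sub (by omega), show 2 * k - 1 - 1 = 2 * k - 2 by omega]
      push_cast
      ring
    have d1 : ∀ t, HasDerivAt (fun t => F t ^ (1 / (k : ℝ)))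
        (2 * F t ^ (1 / (k : ℝ) - 1) * P t) t := fun t => by
      have := (dF t).rpow_const (p := 1 / (k : ℝ)) (Or.inl (hFpos t).ne')
      refine this.congr_deriv ?_
      field_simp
    have d2 : ∀ t, HasDerivAt (fun t => 2 * F t ^ (1 / (k : ℝ) - 1) * P t)
        (2 * F t ^ (1 / (k : ℝ) - 2) * ((2 * k - 1) * (F t * R t) - 2 * (k - 1) * P t ^ 2)) t :=
      fun t => by
      have := (((dF t).rpow_const (p := 1 / (k : ℝ) - 1)
        (Or.inl (hFpos t).ne')).const_mul 2).fun_mul (dP t)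
      refine this.congr_deriv ?_
      rw [show 1 / (k : ℝ) - 1 - 1 = 1 / (k : ℝ) - 2 by ring,
        show F t ^ (1 / (k : ℝ) - 1) = F t ^ (1 / (k : ℝ) - 2) * F t by
          rw [← Real.rpow_add_one (hFpos t).ne']; congr 1; ring]
      field_simp
      ring
    have hR0 : ∀ t, 0 ≤ R t := fun t => Finset.sum_nonneg fun j _ =>
      mul_nonneg ((even_two_mul k |>.tsub even_two).pow_nonneg _) (sq_nonneg _)
    have hCS : ∀ t, P t ^ 2 ≤ F t * R t := fun t => by
      have := Finset.sum_mul_sq_le_sq_mul_sq Finset.univ (fun j => u t j ^ k)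
        (fun j => u t j ^ (k - 1) * y j)
      calc P t ^ 2 = (∑ j, u t j ^ k * (u t j ^ (k - 1) * y j)) ^ 2 := by
            congr 1
            refine Finset.sum_congr rfl fun j _ => ?_
            rw [← mul_assoc, ← pow_add]
            congr 2
            omega
        _ ≤ _ := this
        _ = (∑ j, u t j ^ (2 * k)) * R t := by
            congr 1
            · exact Finset.sum_congr rfl fun j _ => by rw [← pow_mul, mul_comm]
            · refine Finset.sum_congr rfl fun j _ => ?_
              rw [mul_pow, ← pow_mul]
              congr 2
              omega
        _ ≤ F t * R t := by
            gcongr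
            · exact hR0 t
            · simp only [hF]; linarith
    have hRle : ∀ t, R t ≤
        ‖y‖ ^ 2 * ((Fintype.card ι : ℝ) ^ (1 / (k : ℝ)) * F t ^ (1 - 1 / (k : ℝ))) := fun t => by
      calc R t ≤ ∑ j, ‖y‖ ^ 2 * u t j ^ (2 * k - 2) := by
            refine Finset.sum_le_sum fun j _ => ?_
            rw [mul_comm]
            refine mul_le_mul_of_nonneg_right ?_ ((even_two_mul k |>.tsub even_two).pow_nonneg _)
            rw [← sq_abs, ← Real.norm_eq_abs]
            gcongr
            exact norm_le_pi_norm y j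
        _ = ‖y‖ ^ 2 * ∑ j, u t j ^ (2 * k - 2) := by rw [Finset.mul_sum]
        _ ≤ _ := by
            refine mul_le_mul_of_nonneg_left ?_ (by positivity)
            refine (sum_pow_le_card_mul_rpow k hk (u t)).trans ?_
            refine mul_le_mul_of_nonneg_left ?_ (by positivity)
            refine Real.rpow_le_rpow
              (Finset.sum_nonneg fun j _ => (even_two_mul k).pow_nonneg _) ?_ ?_
            · simp only [hF]; linarith
            · rw [sub_nonneg, div_le_one (by positivity)]; linarith
    have := tangent_bounds_of_second_deriv (C := (2 * k - 1) *
      (Fintype.card ι : ℝ) ^ (1 / (k : ℝ)) * ‖y‖ ^ 2) d1 d2 (fun t => ?_) (fun t => ?_)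
    · have e0 : F 0 = δ + ∑ j, x j ^ (2 * k) := by simp [hF, hu]
      have e1 : F 1 = δ + ∑ j, (x + y) j ^ (2 * k) := by simp [hF, hu]
      have eG : 2 * F 0 ^ (1 / (k : ℝ) - 1) * P 0 = ∑ j, powSquareGrad δ k x j * y j := by
        simp only [powSquareGrad, ← e0, hP, Finset.mul_sum]
        exact Finset.sum_congr rfl fun j _ => by simp [hu]; ring
      simp only [e1, eG] at this
      simp only [e0] at this
      exact this
    · have h1 := hCS t
      have h2 := mul_nonneg (hFpos t).le (hR0 t)
      refine mul_nonneg (by have := hFpos t; positivity) ?_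
      nlinarith
    · have hF' := hFpos t
      calc 2 * F t ^ (1 / (k : ℝ) - 2) * ((2 * k - 1) * (F t * R t) - 2 * (k - 1) * P t ^ 2)
          ≤ 2 * F t ^ (1 / (k : ℝ) - 2) * ((2 * k - 1) * (F t * (‖y‖ ^ 2 *
            ((Fintype.card ι : ℝ) ^ (1 / (k : ℝ)) * F t ^ (1 - 1 / (k : ℝ)))))) := by
            gcongr
            have h3 : (2 * (k : ℝ) - 1) * (F t * R t) ≤ (2 * k - 1) * (F t * (‖y‖ ^ 2 *
              ((Fintype.card ι : ℝ) ^ (1 / (k : ℝ)) * F t ^ (1 - 1 / (k : ℝ))))) := by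
              refine mul_le_mul_of_nonneg_left ?_ (by linarith)
              exact mul_le_mul_of_nonneg_left (hRle t) hF'.le
            have h4 : 0 ≤ 2 * ((k : ℝ) - 1) * P t ^ 2 :=
              mul_nonneg (by linarith) (sq_nonneg _)
            linarith
        _ = 2 * ((2 * k - 1) * (Fintype.card ι : ℝ) ^ (1 / (k : ℝ)) * ‖y‖ ^ 2) *
            (F t ^ (1 / (k : ℝ) - 2) * F t * F t ^ (1 - 1 / (k : ℝ))) := by ring
        _ = _ := by
            rw [← Real.rpow_add_one hF'.ne', ← Real.rpow_add hF']
            ring_nf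
            simp
  have hcont : Continuous fun x : ι → ℝ => δ + ∑ j, x j ^ (2 * k) := by fun_prop
  refine ⟨?_, fun x => (Real.rpow_pos_of_pos (powSquare_base_pos hδ k x) _).le, ?_, fun j => ?_, ?_,
    fun x y => (key x y).1, fun x y => (key x y).2⟩
  · have : (0 : ℝ) < Fintype.card ι := by exact_mod_cast Fintype.card_pos
    have : 0 < 2 * (k : ℝ) - 1 := by linarith
    positivity
  · exact hcont.rpow_const fun x => Or.inl (powSquare_base_pos hδ k x).ne'
  · exact ((hcont.rpow_const fun x => Or.inl (powSquare_base_pos hδ k x).ne').const_mul 2).mul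
      (by fun_prop)
  · funext j
    simp [powSquareGrad, show 2 * k - 1 ≠ 0 by omega]

/-! ### Second moments of sums of independent random vectors in the maximum norm -/

namespace IsSmoothSquare

variable {ι : Type*} [Fintype ι] {K : ℝ} {Ψ : (ι → ℝ) → ℝ} {G : (ι → ℝ) → ι → ℝ}

theorem le_add_norm_sq (h : IsSmoothSquare K Ψ G) (x : ι → ℝ) : Ψ x ≤ Ψ 0 + K * ‖x‖ ^ 2 := by
  simpa [h.grad_zero] using h.le_tangent 0 x

/-- Nonnegativity of `Ψ` in the direction opposite to the `j`-th partial derivative. -/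
theorem grad_sq_le (h : IsSmoothSquare K Ψ G) (x : ι → ℝ) (j : ι) :
    G x j ^ 2 ≤ 4 * K * Ψ x := by
  classical
  have h1 := h.le_tangent x (Pi.single j (-(G x j / (2 * K))))
  have h2 := h.nonneg (x + Pi.single j (-(G x j / (2 * K))))
  have hK := h.pos
  simp only [Pi.single_apply, mul_ite, mul_zero, Finset.sum_ite_eq', Finset.mem_univ, if_true,
    Pi.norm_single, norm_neg, Real.norm_eq_abs, sq_abs] at h1
  have e : G x j * -(G x j / (2 * K)) + K * (G x j / (2 * K)) ^ 2 = -(G x j ^ 2 / (4 * K)) := by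
    field_simp
    ring
  have h3 : G x j ^ 2 / (4 * K) ≤ Ψ x := by linarith
  rw [div_le_iff₀ (by positivity)] at h3
  linarith

variable {Ω : Type*} [MeasurableSpace Ω] {P : Measure Ω} [IsProbabilityMeasure P]

theorem integrable_comp (h : IsSmoothSquare K Ψ G) {Z : Ω → ι → ℝ} (hZ : MemLp Z 2 P) :
    Integrable (fun ω => Ψ (Z ω)) P := by
  refine ((integrable_const (Ψ 0)).add (hZ.integrable_norm_pow (by simp) |>.const_mul K)).mono'
    (h.continuous.comp_aestronglyMeasurable hZ.1) (.of_forall fun ω => ?_)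
  rw [Real.norm_of_nonneg (h.nonneg _)]
  simpa using h.le_add_norm_sq (Z ω)

theorem memLp_grad (h : IsSmoothSquare K Ψ G) {Z : Ω → ι → ℝ} (hZ : MemLp Z 2 P) (j : ι) :
    MemLp (fun ω => G (Z ω) j) 2 P := by
  have hm : AEStronglyMeasurable (fun ω => G (Z ω) j) P :=
    (h.continuous_grad j).comp_aestronglyMeasurable hZ.1
  rw [memLp_two_iff_integrable_sq hm]
  refine ((h.integrable_comp hZ).const_mul (4 * K)).mono' (hm.pow 2) (.of_forall fun ω => ?_)
  rw [Real.norm_of_nonneg (sq_nonneg _)]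
  exact h.grad_sq_le _ j

/-- Adding an independent centred vector `X - E[X]` increases `E[Ψ]` by at most `K E‖X‖²`. The
upper tangent bound at `S - E[X]` for the increment `X` and the lower tangent bound at the same
point for the increment `E[X]` have the same expected linear term; so the second moment on the
right is the one of `X` itself, without centring. -/
theorem integral_add_centred_le (h : IsSmoothSquare K Ψ G) {S X : Ω → ι → ℝ} (hS : MemLp S 2 P)
    (hX : MemLp X 2 P) (hind : IndepFun S X P) :
    ∫ ω, Ψ (S ω + (X ω - ∫ ω', X ω' ∂P)) ∂P ≤
      ∫ ω, Ψ (S ω) ∂P + K * ∫ ω, ‖X ω‖ ^ 2 ∂P := by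
  set μ := ∫ ω', X ω' ∂P with hμ
  have hμj : ∀ j, μ j = ∫ ω, X ω j ∂P := fun j =>
    eval_integral (fun i => (hX.eval i).integrable one_le_two) j
  have hSμ : MemLp (fun ω => S ω - μ) 2 P := hS.sub (memLp_const μ)
  have hGX : ∀ j, Integrable (fun ω => G (S ω - μ) j * X ω j) P := fun j =>
    (h.memLp_grad hSμ j).integrable_mul (hX.eval j)
  have hGμ : ∀ j, Integrable (fun ω => G (S ω - μ) j * μ j) P := fun j =>
    ((h.memLp_grad hSμ j).integrable one_le_two).mul_const _
  have hlin : ∀ j, ∫ ω, G (S ω - μ) j * X ω j ∂P = ∫ ω, G (S ω - μ) j * μ j ∂P := fun j => by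
    rw [integral_mul_const, hμj]
    have hi : IndepFun (fun ω => G (S ω - μ) j) (fun ω => X ω j) P :=
      hind.comp (φ := fun s => G (s - μ) j) (ψ := fun x : ι → ℝ => x j)
        ((h.continuous_grad j).comp (continuous_id.sub continuous_const)).measurable
        (measurable_pi_apply j)
    exact hi.integral_mul_eq_mul_integral (h.memLp_grad hSμ j).1 (hX.eval j).1
  have hN := hX.integrable_norm_pow (p := 2) (by simp)
  have i1 := h.integrable_comp hSμ
  have iX := integrable_finsetSum Finset.univ fun j _ => hGX j
  have iμ := integrable_finsetSum Finset.univ fun j _ => hGμ j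
  have up : ∫ ω, Ψ (S ω + (X ω - μ)) ∂P ≤
      ∫ ω, (Ψ (S ω - μ) + ∑ j, G (S ω - μ) j * X ω j + K * ‖X ω‖ ^ 2) ∂P := by
    refine integral_mono (h.integrable_comp (hS.add (hX.sub (memLp_const μ))))
      ((i1.add iX).add (hN.const_mul K)) fun ω => ?_
    have := h.le_tangent (S ω - μ) (X ω)
    rwa [show S ω - μ + X ω = S ω + (X ω - μ) by abel] at this
  have low : ∫ ω, (Ψ (S ω - μ) + ∑ j, G (S ω - μ) j * μ j) ∂P ≤ ∫ ω, Ψ (S ω) ∂P := by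
    refine integral_mono (i1.add iμ) (h.integrable_comp hS) fun ω => ?_
    have := h.tangent_le (S ω - μ) μ
    rwa [sub_add_cancel] at this
  have eX : ∫ ω, (Ψ (S ω - μ) + ∑ j, G (S ω - μ) j * X ω j + K * ‖X ω‖ ^ 2) ∂P =
      ∫ ω, Ψ (S ω - μ) ∂P + ∑ j, ∫ ω, G (S ω - μ) j * X ω j ∂P + K * ∫ ω, ‖X ω‖ ^ 2 ∂P := by
    rw [integral_add (f := fun ω => Ψ (S ω - μ) + ∑ j, G (S ω - μ) j * X ω j) (i1.add iX)
      (hN.const_mul K), integral_add i1 iX,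
      integral_finsetSum _ fun j _ => hGX j, integral_const_mul]
  have eμ : ∫ ω, (Ψ (S ω - μ) + ∑ j, G (S ω - μ) j * μ j) ∂P =
      ∫ ω, Ψ (S ω - μ) ∂P + ∑ j, ∫ ω, G (S ω - μ) j * μ j ∂P := by
    rw [integral_add i1 iμ, integral_finsetSum _ fun j _ => hGμ j]
  rw [eX] at up
  rw [eμ] at low
  simp only [hlin] at up
  linarith

theorem integral_sum_centred_le (h : IsSmoothSquare K Ψ G) {κ : Type*} {X : κ → Ω → ι → ℝ}
    (hX : ∀ i, MemLp (X i) 2 P) (hind : iIndepFun X P) (s : Finset κ) :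
    ∫ ω, Ψ (∑ i ∈ s, (X i ω - ∫ ω', X i ω' ∂P)) ∂P ≤
      Ψ 0 + K * ∑ i ∈ s, ∫ ω, ‖X i ω‖ ^ 2 ∂P := by
  classical
  induction s using Finset.induction_on with
  | empty => simp
  | insert i s hi ih =>
    have hS : MemLp (fun ω => ∑ i ∈ s, (X i ω - ∫ ω', X i ω' ∂P)) 2 P :=
      memLp_finsetSum s fun i _ => (hX i).sub (memLp_const _)
    have hindS : IndepFun (fun ω => ∑ i ∈ s, (X i ω - ∫ ω', X i ω' ∂P)) (X i) P := by
      have := hind.indepFun_finsetSum_of_notMem₀ (fun i => (hX i).1.aemeasurable) hi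
      have := this.comp (φ := fun z => z - ∑ i ∈ s, ∫ ω', X i ω' ∂P) (ψ := id)
        (measurable_id.sub_const _) measurable_id
      convert this using 1
      · funext ω
        simp
      · rfl
    have := h.integral_add_centred_le hS (hX i) hindS
    rw [Finset.sum_insert hi]
    simp only [Finset.sum_insert hi]
    simp only [add_comm (X i _ - _)]
    linarith

end IsSmoothSquare

/-- Nemirovski's inequality for uncentred second moments, with the exponent `2k`. -/
theorem integral_norm_sum_centred_sq_le_rpow {ι κ Ω : Type*} [Fintype ι] [Nonempty ι]
    [MeasurableSpace Ω] {P : Measure Ω} [IsProbabilityMeasure P] {X : κ → Ω → ι → ℝ}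
    (hX : ∀ i, MemLp (X i) 2 P) (hind : iIndepFun X P) (s : Finset κ) {k : ℕ} (hk : 2 ≤ k) :
    ∫ ω, ‖∑ i ∈ s, (X i ω - ∫ ω', X i ω' ∂P)‖ ^ 2 ∂P ≤
      (2 * k - 1) * (Fintype.card ι : ℝ) ^ (1 / (k : ℝ)) *
        ∑ i ∈ s, ∫ ω, ‖X i ω‖ ^ 2 ∂P := by
  -- with `δ = η ^ k` the initial value `Ψ 0` is `η`, which is arbitrarily small
  refine le_of_forall_pos_le_add fun η hη => ?_
  have hδ : 0 < η ^ k := by positivity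
  have h := isSmoothSquare_powSquare (ι := ι) hδ hk
  have hS : MemLp (fun ω => ∑ i ∈ s, (X i ω - ∫ ω', X i ω' ∂P)) 2 P :=
    memLp_finsetSum s fun i _ => (hX i).sub (memLp_const _)
  calc _ ≤ ∫ ω, powSquare (η ^ k) k (∑ i ∈ s, (X i ω - ∫ ω', X i ω' ∂P)) ∂P :=
        integral_mono (hS.integrable_norm_pow (by simp)) (h.integrable_comp hS)
          fun ω => norm_sq_le_powSquare hδ hk _
    _ ≤ _ := h.integral_sum_centred_le hX hind s
    _ = _ := by
      have : powSquare (η ^ k) k (0 : ι → ℝ) = η := by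
        have hk2 : 2 * k ≠ 0 := by omega
        rw [powSquare, one_div]
        simp only [Pi.zero_apply, zero_pow hk2, Finset.sum_const_zero, add_zero]
        exact Real.pow_rpow_inv_natCast hη.le (by omega)
      rw [this, add_comm]

theorem quarter_le_cConst_sum (n : ℕ) (hn : 1 ≤ n) :
    1 / 4 ≤ ∑ k ∈ Finset.Icc 2 (n + 1), ((k : ℝ) ^ 2)⁻¹ * (Real.sqrt (Real.log (k : ℝ)))⁻¹ := by
  have h := Finset.single_le_sum (s := Finset.Icc 2 (n + 1))
    (f := fun k : ℕ => ((k : ℝ) ^ 2)⁻¹ * (Real.sqrt (Real.log (k : ℝ)))⁻¹)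
    (fun k _ => by positivity) (Finset.mem_Icc.2 ⟨le_rfl, by omega⟩)
  refine le_trans ?_ h
  have h2 : Real.sqrt (Real.log 2) ≤ 1 := by
    rw [Real.sqrt_le_one]
    linarith [Real.log_two_lt_d9]
  have h0 : 0 < Real.sqrt (Real.log 2) := Real.sqrt_pos.2 (Real.log_pos one_lt_two)
  have := one_le_inv₀ h0 |>.2 h2
  norm_num
  linarith

/-- With `k = ⌈log n⌉` one has `n^(1/k) ≤ e` and `2k - 1 ≤ 2 log n + 1`; the surplus
`e` in `e (2 log n + 1)` is absorbed by the first term of the series in `cConst n`. -/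
theorem rpow_const_le_cConst (n : ℕ) (hn : 4 ≤ n) :
    (2 * (⌈Real.log n⌉₊ : ℝ) - 1) * (n : ℝ) ^ (1 / (⌈Real.log n⌉₊ : ℝ)) ≤ cConst n := by
  have hn' : (4 : ℝ) ≤ n := by exact_mod_cast hn
  have hlog4 : 1.38 ≤ Real.log 4 := by
    rw [show (4 : ℝ) = 2 ^ 2 by norm_num, Real.log_pow]
    norm_num
    linarith [Real.log_two_gt_d9]
  have hlog : 1.38 ≤ Real.log n := hlog4.trans (Real.log_le_log (by norm_num) hn')
  have hlog5 : 1.58 ≤ Real.log (n + 1) := by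
    have h5 : Real.log 4 + 1 / 5 ≤ Real.log 5 := by
      have : 1 - (5 / 4 : ℝ)⁻¹ ≤ Real.log (5 / 4) := Real.one_sub_inv_le_log_of_pos (by norm_num)
      rw [Real.log_div (by norm_num) (by norm_num)] at this
      norm_num at this ⊢
      linarith
    have h4 : 1.386 ≤ Real.log 4 := by
      rw [show (4 : ℝ) = 2 ^ 2 by norm_num, Real.log_pow]
      norm_num
      linarith [Real.log_two_gt_d9]
    have : Real.log 5 ≤ Real.log (n + 1) := Real.log_le_log (by norm_num) (by linarith)
    norm_num at *
    linarith
  have hk : Real.log n ≤ (⌈Real.log n⌉₊ : ℝ) := Nat.le_ceil _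
  have hk1 : (⌈Real.log n⌉₊ : ℝ) < Real.log n + 1 := Nat.ceil_lt_add_one (by linarith)
  have hpow : (n : ℝ) ^ (1 / (⌈Real.log n⌉₊ : ℝ)) ≤ Real.exp 1 := by
    rw [Real.rpow_def_of_pos (by linarith)]
    refine Real.exp_le_exp.2 ?_
    rw [mul_one_div, div_le_one (by linarith)]
    exact hk
  have hmono : Real.log n ≤ Real.log (n + 1) := Real.log_le_log (by linarith) (by linarith)
  have h1 : (2 * (⌈Real.log n⌉₊ : ℝ) - 1) * (n : ℝ) ^ (1 / (⌈Real.log n⌉₊ : ℝ)) ≤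
      (2 * Real.log (n + 1) + 1) * Real.exp 1 := by
    refine mul_le_mul (by linarith) hpow (by positivity) (by linarith)
  refine h1.trans ?_
  have hsum := quarter_le_cConst_sum n (by omega)
  have he : Real.exp 1 < 2.72 := by linarith [Real.exp_one_lt_d9]
  have hπ : 3.14 < Real.pi := Real.pi_gt_d2
  have hπ' : Real.pi < 3.15 := Real.pi_lt_d2
  have hs : 1.59 ≤ Real.sqrt (8 / Real.pi) := by
    refine Real.le_sqrt_of_sq_le ?_
    rw [le_div_iff₀ Real.pi_pos]
    norm_num at *
    linarith
  rw [cConst]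
  have h2 : 1.59 * (1 / 4) ≤ Real.sqrt (8 / Real.pi) *
      ∑ k ∈ Finset.Icc 2 (n + 1), ((k : ℝ) ^ 2)⁻¹ * (Real.sqrt (Real.log (k : ℝ)))⁻¹ :=
    mul_le_mul hs hsum (by norm_num) (Real.sqrt_nonneg _)
  set T := Real.sqrt (8 / Real.pi) *
      ∑ k ∈ Finset.Icc 2 (n + 1), ((k : ℝ) ^ 2)⁻¹ * (Real.sqrt (Real.log (k : ℝ)))⁻¹
  set Λ := Real.log ((n : ℝ) + 1)
  calc (2 * Λ + 1) * Real.exp 1 ≤ (2 * Λ + 1) * 2.72 := by gcongr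
    _ ≤ 6.28 * (Λ + 1.59 * (1 / 4)) := by norm_num at *; linarith
    _ ≤ 2 * Real.pi * (Λ + T) := by
      refine mul_le_mul (by norm_num at *; linarith) (by linarith) (by norm_num at *; linarith)
        (by positivity)

/-- The constant `cConst n` bounds the growth of the second moment of the maximum norm under
summation of independent vectors of `ℝⁿ`. -/
theorem integral_norm_sum_centred_sq_le {n : ℕ} (hn : 4 ≤ n) {κ Ω : Type*}
    [MeasurableSpace Ω] {P : Measure Ω} [IsProbabilityMeasure P] {X : κ → Ω → Fin n → ℝ}
    (hX : ∀ i, MemLp (X i) 2 P) (hind : iIndepFun X P) (s : Finset κ) :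
    ∫ ω, ‖∑ i ∈ s, (X i ω - ∫ ω', X i ω' ∂P)‖ ^ 2 ∂P ≤
      cConst n * ∑ i ∈ s, ∫ ω, ‖X i ω‖ ^ 2 ∂P := by
  have : Nonempty (Fin n) := ⟨⟨0, by omega⟩⟩
  have hk : 2 ≤ ⌈Real.log n⌉₊ := by
    refine Nat.lt_ceil.2 ?_
    have hn' : (4 : ℝ) ≤ n := by exact_mod_cast hn
    have := Real.log_le_log (by norm_num) hn'
    rw [show (4 : ℝ) = 2 ^ 2 by norm_num, Real.log_pow] at this
    push_cast at this ⊢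
    linarith [Real.log_two_gt_d9]
  have h := integral_norm_sum_centred_sq_le_rpow hX hind s hk
  rw [Fintype.card_fin] at h
  refine h.trans (mul_le_mul_of_nonneg_right (rpow_const_le_cConst n hn) ?_)
  exact Finset.sum_nonneg fun i _ => integral_nonneg fun ω => sq_nonneg _

/-! ### The norm of `L^∞` on an interval -/

theorem supNorm_le_of_forall {a b C : ℝ} {g : ℝ → ℝ} (h : ∀ t ∈ Icc a b, |g t| ≤ C) :
    supNorm a b g ≤ ENNReal.ofReal C := by
  rw [supNorm, eLpNorm_exponent_top]
  refine eLpNormEssSup_le_of_ae_bound ?_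
  rw [ae_restrict_iff' measurableSet_Icc]
  exact .of_forall fun t ht => h t ht

theorem supNorm_congr {a b : ℝ} {g₁ g₂ : ℝ → ℝ} (h : EqOn g₁ g₂ (Icc a b)) :
    supNorm a b g₁ = supNorm a b g₂ := by
  refine eLpNorm_congr_ae ?_
  rw [Filter.EventuallyEq, ae_restrict_iff' measurableSet_Icc]
  exact .of_forall fun t ht => h ht

theorem supNorm_add_le (a b : ℝ) (g₁ g₂ : ℝ → ℝ) :
    supNorm a b (fun t => g₁ t + g₂ t) ≤ supNorm a b g₁ + supNorm a b g₂ := by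
  simp only [supNorm, eLpNorm_exponent_top]
  exact eLpNormEssSup_add_le

theorem supNorm_neg (a b : ℝ) (g : ℝ → ℝ) : supNorm a b (fun t => -g t) = supNorm a b g :=
  eLpNorm_neg g ⊤ _

theorem supNorm_ne_top {a b : ℝ} {g : ℝ → ℝ} (hg : ContinuousOn g (Icc a b)) :
    supNorm a b g ≠ ⊤ := by
  obtain ⟨C, hC⟩ := isCompact_Icc.exists_bound_of_continuousOn hg
  exact ((supNorm_le_of_forall hC).trans_lt ENNReal.ofReal_lt_top).ne

/-- For a continuous function the essential supremum bounds every value. -/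
theorem abs_le_toReal_supNorm {a b : ℝ} (hab : a < b) {g : ℝ → ℝ} (hg : ContinuousOn g (Icc a b))
    {t : ℝ} (ht : t ∈ Icc a b) : |g t| ≤ (supNorm a b g).toReal := by
  set C := (supNorm a b g).toReal
  have hae : (fun t => min |g t| C) =ᵐ[volume.restrict (Icc a b)] fun t => |g t| := by
    have := ae_le_eLpNormEssSup (f := g) (μ := volume.restrict (Icc a b))
    filter_upwards [this] with t ht
    refine min_eq_left ?_
    rw [← eLpNorm_exponent_top] at ht
    have := ENNReal.toReal_mono (supNorm_ne_top hg) ht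
    simpa using this
  have := Measure.eqOn_Icc_of_ae_eq volume hab.ne hae (hg.abs.inf continuousOn_const) hg.abs ht
  simp only [inf_eq_left] at this
  exact this

/-! ### Derivatives on an interval -/

theorem hasDerivWithinAt_derivOn {a b : ℝ} (hab : a < b) {g : ℝ → ℝ} {k m : ℕ}
    (hg : ContDiffOn ℝ k g (Icc a b)) (hm : m < k) {t : ℝ} (ht : t ∈ Icc a b) :
    HasDerivWithinAt (derivOn a b m g) (derivOn a b (m + 1) g t) (Icc a b) t := by
  have := (hg.differentiableOn_iteratedDerivWithin (m := m) (by exact_mod_cast hm)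
    (uniqueDiffOn_Icc hab)) t ht
  rw [derivOn, derivOn, iteratedDerivWithin_succ]
  exact this.hasDerivWithinAt

theorem derivOn_zero (a b : ℝ) (g : ℝ → ℝ) : derivOn a b 0 g = g := iteratedDerivWithin_zero

theorem continuousOn_derivOn {a b : ℝ} (hab : a < b) {g : ℝ → ℝ} {k m : ℕ}
    (hg : ContDiffOn ℝ k g (Icc a b)) (hm : m ≤ k) : ContinuousOn (derivOn a b m g) (Icc a b) :=
  hg.continuousOn_iteratedDerivWithin (by exact_mod_cast hm) (uniqueDiffOn_Icc hab)

/-- A function with derivative bounded by `C` on `[u, v]` varies there by at most `C (v - u)`. -/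
theorem abs_sub_le_of_deriv_le {u v C : ℝ} {g g' : ℝ → ℝ}
    (hg : ∀ t ∈ Icc u v, HasDerivWithinAt g (g' t) (Icc u v) t) (hC : ∀ t ∈ Icc u v, |g' t| ≤ C)
    {s t : ℝ} (hs : s ∈ Icc u v) (ht : t ∈ Icc u v) : |g t - g s| ≤ C * (v - u) := by
  have h := (convex_Icc u v).norm_image_sub_le_of_norm_hasDerivWithin_le hg hC hs ht
  have h0 : 0 ≤ C := (abs_nonneg _).trans (hC s hs)
  refine h.trans (mul_le_mul_of_nonneg_left ?_ h0)
  rw [Real.norm_eq_abs, abs_le]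
  constructor <;> linarith [hs.1, hs.2, ht.1, ht.2]

/-- A function with end point values bounded by `A` and second derivative bounded by `B`; the mean
value theorem provides a point where the first derivative is at most `2A / (v - u)`. -/
theorem abs_le_of_second_deriv_le {u v A B : ℝ} (huv : u < v) {e e₁ e₂ : ℝ → ℝ}
    (h₁ : ∀ t ∈ Icc u v, HasDerivWithinAt e (e₁ t) (Icc u v) t)
    (h₂ : ∀ t ∈ Icc u v, HasDerivWithinAt e₁ (e₂ t) (Icc u v) t)
    (hu : |e u| ≤ A) (hv : |e v| ≤ A) (hB : ∀ t ∈ Icc u v, |e₂ t| ≤ B) {t : ℝ}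
    (ht : t ∈ Icc u v) :
    |e₁ t| ≤ 2 * A / (v - u) + B * (v - u) ∧ |e t| ≤ 3 * A + B * (v - u) ^ 2 := by
  have hd : 0 < v - u := sub_pos.2 huv
  have first : ∀ t ∈ Icc u v, |e₁ t| ≤ 2 * A / (v - u) + B * (v - u) := by
    intro t ht
    obtain ⟨ζ, hζ, hζe⟩ := exists_hasDerivAt_eq_slope e e₁ huv
      (fun t ht => (h₁ t ht).continuousWithinAt)
      (fun t ht => (h₁ t (Ioo_subset_Icc_self ht)).hasDerivAt (Icc_mem_nhds ht.1 ht.2))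
    have h3 := abs_sub_le_of_deriv_le h₂ hB (Ioo_subset_Icc_self hζ) ht
    have h4 : |e₁ ζ| ≤ 2 * A / (v - u) := by
      rw [hζe, abs_div, abs_of_pos hd]
      gcongr
      have := abs_sub (e v) (e u)
      linarith
    calc |e₁ t| = |(e₁ t - e₁ ζ) + e₁ ζ| := by rw [sub_add_cancel]
      _ ≤ |e₁ t - e₁ ζ| + |e₁ ζ| := abs_add_le _ _
      _ ≤ _ := by linarith
  refine ⟨first t ht, ?_⟩
  have h3 := abs_sub_le_of_deriv_le h₁ first (left_mem_Icc.2 huv.le) ht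
  have e1 : (2 * A / (v - u) + B * (v - u)) * (v - u) = 2 * A + B * (v - u) ^ 2 := by
    field_simp
  rw [e1] at h3
  calc |e t| = |(e t - e u) + e u| := by rw [sub_add_cancel]
    _ ≤ |e t - e u| + |e u| := abs_add_le _ _
    _ ≤ _ := by linarith

/-- Taylor's formula of degree three at the left end point, for the function and its second
derivative, with remainder bounds in which the factorials are left out. -/
theorem exists_cubic_approx {u v D : ℝ} {f f₁ f₂ f₃ f₄ : ℝ → ℝ}
    (h₁ : ∀ t ∈ Icc u v, HasDerivWithinAt f (f₁ t) (Icc u v) t)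
    (h₂ : ∀ t ∈ Icc u v, HasDerivWithinAt f₁ (f₂ t) (Icc u v) t)
    (h₃ : ∀ t ∈ Icc u v, HasDerivWithinAt f₂ (f₃ t) (Icc u v) t)
    (h₄ : ∀ t ∈ Icc u v, HasDerivWithinAt f₃ (f₄ t) (Icc u v) t)
    (hD : ∀ t ∈ Icc u v, |f₄ t| ≤ D) :
    ∃ c₀ c₁ c₂ c₃ : ℝ, ∀ t ∈ Icc u v,
      |f t - (c₀ + c₁ * (t - u) + c₂ * (t - u) ^ 2 + c₃ * (t - u) ^ 3)| ≤ D * (v - u) ^ 4 ∧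
      |f₂ t - (2 * c₂ + 6 * c₃ * (t - u))| ≤ D * (v - u) ^ 2 := by
  refine ⟨f u, f₁ u, f₂ u / 2, f₃ u / 6, fun t ht => ?_⟩
  have hu : u ∈ Icc u v := left_mem_Icc.2 (ht.1.trans ht.2)
  have b3 : ∀ t ∈ Icc u v, |f₃ t - f₃ u| ≤ D * (v - u) := fun t ht =>
    abs_sub_le_of_deriv_le h₄ hD hu ht
  have b2 : ∀ t ∈ Icc u v, |f₂ t - (f₂ u + f₃ u * (t - u))| ≤ D * (v - u) * (v - u) :=
    fun t ht => by
    have := abs_sub_le_of_deriv_le (g := fun t => f₂ t - (f₂ u + f₃ u * (t - u)))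
      (g' := fun t => f₃ t - f₃ u) (fun t ht => ?_) b3 hu ht
    · simpa using this
    · exact ((h₃ t ht).fun_sub ((((hasDerivWithinAt_id t _).sub_const u).const_mul
        (f₃ u)).const_add (f₂ u))).congr_deriv (by ring)
  have b1 : ∀ t ∈ Icc u v, |f₁ t - (f₁ u + f₂ u * (t - u) + f₃ u / 2 * (t - u) ^ 2)| ≤
      D * (v - u) * (v - u) * (v - u) := fun t ht => by
    have := abs_sub_le_of_deriv_le
      (g := fun t => f₁ t - (f₁ u + f₂ u * (t - u) + f₃ u / 2 * (t - u) ^ 2))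
      (g' := fun t => f₂ t - (f₂ u + f₃ u * (t - u))) (fun t ht => ?_) b2 hu ht
    · simpa using this
    · have hid := (hasDerivWithinAt_id t (Icc u v)).sub_const u
      exact ((h₂ t ht).fun_sub (((hid.const_mul (f₂ u)).const_add (f₁ u)).fun_add
        ((hid.fun_pow 2).const_mul (f₃ u / 2)))).congr_deriv (by simp; ring)
  have b0 := abs_sub_le_of_deriv_le
      (g := fun t => f t - (f u + f₁ u * (t - u) + f₂ u / 2 * (t - u) ^ 2 +
        f₃ u / 6 * (t - u) ^ 3))
      (g' := fun t => f₁ t - (f₁ u + f₂ u * (t - u) + f₃ u / 2 * (t - u) ^ 2))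
      (fun t ht => by
        have hid := (hasDerivWithinAt_id t (Icc u v)).sub_const u
        exact ((h₁ t ht).fun_sub ((((hid.const_mul (f₁ u)).const_add (f u)).fun_add
          ((hid.fun_pow 2).const_mul (f₂ u / 2))).fun_add
          ((hid.fun_pow 3).const_mul (f₃ u / 6)))).congr_deriv (by simp; ring)) b1 hu ht
  constructor
  · have e : D * (v - u) * (v - u) * (v - u) * (v - u) = D * (v - u) ^ 4 := by ring
    rw [← e]
    simpa using b0
  · have := b2 t ht
    have e : D * (v - u) * (v - u) = D * (v - u) ^ 2 := by ring
    rw [← e]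
    convert this using 2
    ring

/-! ### The uniform grid -/

/-- The distance of neighbouring nodes. -/
noncomputable def gridStep (a b : ℝ) (n : ℕ) : ℝ := (b - a) / ((n : ℝ) - 1)

section Grid

variable {a b : ℝ} {n : ℕ}

theorem natCast_sub_one_pos (hn : 4 ≤ n) : (0 : ℝ) < (n : ℝ) - 1 := by
  have : (4 : ℝ) ≤ n := by exact_mod_cast hn
  linarith

theorem gridStep_pos (hab : a < b) (hn : 4 ≤ n) : 0 < gridStep a b n :=
  div_pos (sub_pos.2 hab) (natCast_sub_one_pos hn)

theorem gridNode_eq (j : ℕ) : gridNode a b n j = a + j * gridStep a b n := rfl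

theorem gridNode_add (j k : ℕ) :
    gridNode a b n (j + k) = gridNode a b n j + k * gridStep a b n := by
  simp only [gridNode_eq]
  push_cast
  ring

theorem gridNode_last (hn : 4 ≤ n) : gridNode a b n (n - 1) = b := by
  have := natCast_sub_one_pos hn
  rw [gridNode, Nat.cast_sub (by omega)]
  push_cast
  field_simp
  ring

theorem gridNode_mono (hab : a < b) (hn : 4 ≤ n) : Monotone (gridNode a b n) := fun i j hij => by
  have := gridStep_pos hab hn
  have hij' : (i : ℝ) ≤ j := by exact_mod_cast hij
  simp only [gridNode_eq]
  gcongr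

theorem gridNode_mem (hab : a < b) (hn : 4 ≤ n) {j : ℕ} (hj : j < n) :
    gridNode a b n j ∈ Icc a b := by
  constructor
  · have := gridNode_mono hab hn (Nat.zero_le j)
    simpa [gridNode_eq] using this
  · have := gridNode_mono hab hn (show j ≤ n - 1 by omega)
    rwa [gridNode_last hn] at this

theorem Icc_gridNode_subset (hab : a < b) (hn : 4 ≤ n) {i j : ℕ} (hi : i < n) (hj : j < n) :
    Icc (gridNode a b n i) (gridNode a b n j) ⊆ Icc a b :=
  Icc_subset_Icc (gridNode_mem hab hn hi).1 (gridNode_mem hab hn hj).2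

theorem exists_mem_gridCell (hn : 4 ≤ n) {t : ℝ} (ht : t ∈ Icc a b) :
    ∃ j, j + 1 < n ∧ t ∈ Icc (gridNode a b n j) (gridNode a b n (j + 1)) := by
  have hP : ∃ j, t ≤ gridNode a b n (j + 1) := ⟨n - 2, by
    rw [show n - 2 + 1 = n - 1 by omega, gridNode_last hn]; exact ht.2⟩
  classical
  refine ⟨Nat.find hP, ?_, ?_, Nat.find_spec hP⟩
  · have : Nat.find hP ≤ n - 2 := Nat.find_min' hP (by
      rw [show n - 2 + 1 = n - 1 by omega, gridNode_last hn]; exact ht.2)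
    omega
  · rcases Nat.eq_zero_or_pos (Nat.find hP) with h | h
    · rw [h]
      simpa [gridNode_eq] using ht.1
    · have := Nat.find_min hP (m := Nat.find hP - 1) (by omega)
      rw [show Nat.find hP - 1 + 1 = Nat.find hP by omega] at this
      exact (not_le.1 this).le

end Grid

/-! ### Piecewise cubic functions -/

theorem isCubicOn_iff {s : ℝ → ℝ} {u v : ℝ} (t₀ : ℝ) :
    IsCubicOn s u v ↔ ∃ c₀ c₁ c₂ c₃ : ℝ, ∀ t ∈ Icc u v,
      s t = c₀ + c₁ * (t - t₀) + c₂ * (t - t₀) ^ 2 + c₃ * (t - t₀) ^ 3 := by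
  constructor
  · rintro ⟨p, hp, h⟩
    set q := p.comp (Polynomial.X + Polynomial.C t₀) with hq
    have hqd : q.natDegree < 4 := by
      have : q.natDegree = p.natDegree := by
        rw [hq, Polynomial.natDegree_comp, Polynomial.natDegree_X_add_C, mul_one]
      omega
    refine ⟨q.coeff 0, q.coeff 1, q.coeff 2, q.coeff 3, fun t ht => ?_⟩
    have e : p.eval t = q.eval (t - t₀) := by simp [hq, Polynomial.eval_comp]
    rw [h t ht, e, Polynomial.eval_eq_sum_range' hqd]
    simp [Finset.sum_range_succ]
  · rintro ⟨c₀, c₁, c₂, c₃, h⟩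
    refine ⟨Polynomial.C c₀ + Polynomial.C c₁ * (Polynomial.X - Polynomial.C t₀) +
      Polynomial.C c₂ * (Polynomial.X - Polynomial.C t₀) ^ 2 +
      Polynomial.C c₃ * (Polynomial.X - Polynomial.C t₀) ^ 3, by compute_degree, fun t ht => ?_⟩
    rw [h t ht]
    simp

theorem IsCubicOn.linear_comb {s₁ s₂ : ℝ → ℝ} {u v : ℝ} (h₁ : IsCubicOn s₁ u v)
    (h₂ : IsCubicOn s₂ u v) (r : ℝ) : IsCubicOn (fun t => s₁ t + r * s₂ t) u v := by
  obtain ⟨a₀, a₁, a₂, a₃, ha⟩ := (isCubicOn_iff 0).1 h₁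
  obtain ⟨b₀, b₁, b₂, b₃, hb⟩ := (isCubicOn_iff 0).1 h₂
  refine (isCubicOn_iff 0).2 ⟨a₀ + r * b₀, a₁ + r * b₁, a₂ + r * b₂, a₃ + r * b₃, fun t ht => ?_⟩
  rw [ha t ht, hb t ht]
  ring

theorem IsSplineInterpolant.linear_comb {a b : ℝ} {n : ℕ} {x y : Fin n → ℝ} {s₁ s₂ : ℝ → ℝ}
    (h₁ : IsSplineInterpolant a b n x s₁) (h₂ : IsSplineInterpolant a b n y s₂) (r : ℝ) :
    IsSplineInterpolant a b n (fun j => x j + r * y j) (fun t => s₁ t + r * s₂ t) where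
  contDiffOn := h₁.contDiffOn.add (contDiffOn_const.mul h₂.contDiffOn)
  interpolates j := by rw [h₁.interpolates, h₂.interpolates]
  cubic j hj := (h₁.cubic j hj).linear_comb (h₂.cubic j hj) r
  left_end := h₁.left_end.linear_comb h₂.left_end r
  right_end := h₁.right_end.linear_comb h₂.right_end r

/-- On a subinterval where a `C²` function is a cubic polynomial, the first two derivatives on the
whole interval are the ones of the polynomial, also at the end points. -/
theorem derivOn_of_cubic {a b u v t₀ c₀ c₁ c₂ c₃ : ℝ} {s : ℝ → ℝ} (hab : a < b) (huv : u < v)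
    (hsub : Icc u v ⊆ Icc a b) (hs : ContDiffOn ℝ 2 s (Icc a b))
    (h : ∀ t ∈ Icc u v, s t = c₀ + c₁ * (t - t₀) + c₂ * (t - t₀) ^ 2 + c₃ * (t - t₀) ^ 3) {t : ℝ}
    (ht : t ∈ Icc u v) :
    derivOn a b 1 s t = c₁ + 2 * c₂ * (t - t₀) + 3 * c₃ * (t - t₀) ^ 2 ∧
      derivOn a b 2 s t = 2 * c₂ + 6 * c₃ * (t - t₀) := by
  have first : ∀ t ∈ Icc u v,
      derivOn a b 1 s t = c₁ + 2 * c₂ * (t - t₀) + 3 * c₃ * (t - t₀) ^ 2 := by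
    intro t ht
    have d := (hasDerivWithinAt_derivOn (k := 2) (m := 0) hab hs (by norm_num) (hsub ht)).mono hsub
    rw [derivOn_zero] at d
    refine (uniqueDiffOn_Icc huv t ht).eq_deriv _ d ?_
    have hid := (hasDerivWithinAt_id t (Icc u v)).sub_const t₀
    refine HasDerivWithinAt.congr_of_mem ?_ h ht
    exact ((((hid.const_mul c₁).const_add c₀).fun_add ((hid.fun_pow 2).const_mul c₂)).fun_add
          ((hid.fun_pow 3).const_mul c₃)).congr_deriv (by simp; ring)
  refine ⟨first t ht, ?_⟩
  have d := (hasDerivWithinAt_derivOn (k := 2) (m := 1) hab hs (by norm_num) (hsub ht)).mono hsub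
  refine (uniqueDiffOn_Icc huv t ht).eq_deriv _ d ?_
  have hid := (hasDerivWithinAt_id t (Icc u v)).sub_const t₀
  refine HasDerivWithinAt.congr_of_mem ?_ first ht
  exact (((hid.const_mul (2 * c₂)).const_add c₁).fun_add
    ((hid.fun_pow 2).const_mul (3 * c₃))).congr_deriv (by simp; ring)

/-- The maximum principle for the diagonally dominant recursion `E_j + 4 E_{j+1} + E_{j+2}`. -/
theorem abs_le_of_tridiagonal {N : ℕ} {R : ℝ} {E : ℕ → ℝ} (h1 : |E 1| ≤ R) (hN : |E (N - 1)| ≤ R)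
    (h : ∀ j, 1 ≤ j → j + 2 ≤ N - 1 → |E j + 4 * E (j + 1) + E (j + 2)| ≤ 2 * R) {j : ℕ}
    (hj1 : 1 ≤ j) (hjN : j ≤ N - 1) : |E j| ≤ R := by
  obtain ⟨i, hi, hmax⟩ := Finset.exists_max_image (Finset.Icc 1 (N - 1)) (fun j => |E j|)
    ⟨j, Finset.mem_Icc.2 ⟨hj1, hjN⟩⟩
  refine (hmax j (Finset.mem_Icc.2 ⟨hj1, hjN⟩)).trans ?_
  rw [Finset.mem_Icc] at hi
  rcases eq_or_ne i 1 with rfl | hi1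
  · exact h1
  rcases eq_or_ne i (N - 1) with rfl | hiN
  · exact hN
  obtain ⟨k, rfl⟩ : ∃ k, i = k + 1 := ⟨i - 1, by omega⟩
  have ha := hmax k (Finset.mem_Icc.2 ⟨by omega, by omega⟩)
  have hb := hmax (k + 2) (Finset.mem_Icc.2 ⟨by omega, by omega⟩)
  have hc := h k (by omega) (by omega)
  have : 4 * |E (k + 1)| ≤ |E k + 4 * E (k + 1) + E (k + 2)| + |E k| + |E (k + 2)| := by
    calc 4 * |E (k + 1)| = |4 * E (k + 1)| := by rw [abs_mul]; norm_num
      _ = |(E k + 4 * E (k + 1) + E (k + 2)) + -E k + -E (k + 2)| := by congr 1; ring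
      _ ≤ _ := by
        refine (abs_add_le _ _).trans ?_
        rw [abs_neg]
        gcongr
        refine (abs_add_le _ _).trans ?_
        rw [abs_neg]
  linarith

namespace IsSplineInterpolant

variable {a b : ℝ} {n : ℕ} {x : Fin n → ℝ} {s : ℝ → ℝ}

/-- The cubic on a union of cells, with the derivatives of the spline on it. -/
theorem exists_coeff_of_isCubicOn (h : IsSplineInterpolant a b n x s) (hab : a < b) (hn : 4 ≤ n)
    {i j : ℕ} (hij : i < j) (hj : j < n)
    (hc : IsCubicOn s (gridNode a b n i) (gridNode a b n j)) (t₀ : ℝ) :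
    ∃ c₀ c₁ c₂ c₃ : ℝ, ∀ t ∈ Icc (gridNode a b n i) (gridNode a b n j),
      s t = c₀ + c₁ * (t - t₀) + c₂ * (t - t₀) ^ 2 + c₃ * (t - t₀) ^ 3 ∧
      derivOn a b 1 s t = c₁ + 2 * c₂ * (t - t₀) + 3 * c₃ * (t - t₀) ^ 2 ∧
      derivOn a b 2 s t = 2 * c₂ + 6 * c₃ * (t - t₀) := by
  obtain ⟨c₀, c₁, c₂, c₃, H⟩ := (isCubicOn_iff t₀).1 hc
  have hlt : gridNode a b n i < gridNode a b n j := by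
    have h1 := gridStep_pos hab hn
    have h2 : (i : ℝ) < j := by exact_mod_cast hij
    simp only [gridNode_eq]
    gcongr
  exact ⟨c₀, c₁, c₂, c₃, fun t ht => ⟨H t ht, derivOn_of_cubic hab hlt
    (Icc_gridNode_subset hab hn (hij.trans hj) hj) h.contDiffOn H ht⟩⟩

theorem gridNode_mem_cell (hab : a < b) (hn : 4 ≤ n) {i j k : ℕ} (hij : i ≤ j) (hjk : j ≤ k) :
    gridNode a b n j ∈ Icc (gridNode a b n i) (gridNode a b n k) :=
  ⟨gridNode_mono hab hn hij, gridNode_mono hab hn hjk⟩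

/-- The relation between the second derivatives of the spline and the second differences of its
values; it expresses the continuity of the first derivative at the middle node. -/
theorem moment_relation (h : IsSplineInterpolant a b n x s) (hab : a < b) (hn : 4 ≤ n) {j : ℕ}
    (hj : j + 2 < n) :
    gridStep a b n ^ 2 * (derivOn a b 2 s (gridNode a b n j) +
        4 * derivOn a b 2 s (gridNode a b n (j + 1)) +
        derivOn a b 2 s (gridNode a b n (j + 2))) =
      6 * (s (gridNode a b n (j + 2)) - 2 * s (gridNode a b n (j + 1)) +
        s (gridNode a b n j)) := by
  obtain ⟨c₀, c₁, c₂, c₃, H⟩ := h.exists_coeff_of_isCubicOn hab hn (Nat.lt_succ_self j) (by omega)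
    (h.cubic j (by omega)) (gridNode a b n (j + 1))
  obtain ⟨d₀, d₁, d₂, d₃, H'⟩ := h.exists_coeff_of_isCubicOn hab hn (Nat.lt_succ_self (j + 1))
    (by omega) (h.cubic (j + 1) (by omega)) (gridNode a b n (j + 1))
  obtain ⟨p0, p1, p2⟩ := H _ (gridNode_mem_cell hab hn (j := j) le_rfl (by omega))
  obtain ⟨q0, q1, q2⟩ := H _ (gridNode_mem_cell hab hn (j := j + 1) (by omega) le_rfl)
  obtain ⟨q0', q1', q2'⟩ := H' _ (gridNode_mem_cell hab hn (j := j + 1) le_rfl (by omega))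
  obtain ⟨r0, r1, r2⟩ := H' _ (gridNode_mem_cell hab hn (j := j + 2) (by omega) le_rfl)
  have e1 : gridNode a b n (j + 1) = gridNode a b n j + gridStep a b n := by
    rw [gridNode_add]; simp
  have e2 : gridNode a b n (j + 2) = gridNode a b n j + 2 * gridStep a b n := by
    rw [gridNode_add]; simp
  have d1 : gridNode a b n j - gridNode a b n (j + 1) = -gridStep a b n := by rw [e1]; ring
  have d2 : gridNode a b n (j + 2) - gridNode a b n (j + 1) = gridStep a b n := by
    rw [e1, e2]; ring
  rw [sub_self] at q0 q1 q2 q0' q1' q2'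
  rw [d1] at p0 p1 p2
  rw [d2] at r0 r1 r2
  rw [p2, r2, q2, p0, r0, q0]
  have g0 : c₀ = d₀ := by simpa using q0.symm.trans q0'
  have g1 : c₁ = d₁ := by simpa using q1.symm.trans q1'
  have g2 : c₂ = d₂ := by simpa using q2.symm.trans q2'
  rw [g0, g1, g2]
  ring

/-- A not-a-knot condition: across three nodes on one cubic, the second derivative is linear and
its middle value is given by the second difference of the values. -/
theorem moment_relation_of_isCubicOn (h : IsSplineInterpolant a b n x s) (hab : a < b) (hn : 4 ≤ n)
    {j : ℕ} (hj : j + 2 < n) (hc : IsCubicOn s (gridNode a b n j) (gridNode a b n (j + 2))) :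
    gridStep a b n ^ 2 * derivOn a b 2 s (gridNode a b n (j + 1)) =
        s (gridNode a b n (j + 2)) - 2 * s (gridNode a b n (j + 1)) + s (gridNode a b n j) ∧
      derivOn a b 2 s (gridNode a b n j) - 2 * derivOn a b 2 s (gridNode a b n (j + 1)) +
        derivOn a b 2 s (gridNode a b n (j + 2)) = 0 := by
  obtain ⟨c₀, c₁, c₂, c₃, H⟩ := h.exists_coeff_of_isCubicOn hab hn (by omega) hj hc
    (gridNode a b n (j + 1))
  obtain ⟨p0, p1, p2⟩ := H _ (gridNode_mem_cell hab hn (j := j) le_rfl (by omega))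
  obtain ⟨q0, q1, q2⟩ := H _ (gridNode_mem_cell hab hn (j := j + 1) (by omega) (by omega))
  obtain ⟨r0, r1, r2⟩ := H _ (gridNode_mem_cell hab hn (j := j + 2) (by omega) le_rfl)
  have e1 : gridNode a b n (j + 1) = gridNode a b n j + gridStep a b n := by
    rw [gridNode_add]; simp
  have e2 : gridNode a b n (j + 2) = gridNode a b n j + 2 * gridStep a b n := by
    rw [gridNode_add]; simp
  have d1 : gridNode a b n j - gridNode a b n (j + 1) = -gridStep a b n := by rw [e1]; ring
  have d2 : gridNode a b n (j + 2) - gridNode a b n (j + 1) = gridStep a b n := by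
    rw [e1, e2]; ring
  rw [d1] at p0 p2
  rw [d2] at r0 r2
  rw [p2, q2, r2, p0, q0, r0]
  constructor <;> ring

theorem moment_relation_left (h : IsSplineInterpolant a b n x s) (hab : a < b) (hn : 4 ≤ n) :
    gridStep a b n ^ 2 * derivOn a b 2 s (gridNode a b n 1) =
        s (gridNode a b n 2) - 2 * s (gridNode a b n 1) + s (gridNode a b n 0) ∧
      derivOn a b 2 s (gridNode a b n 0) - 2 * derivOn a b 2 s (gridNode a b n 1) +
        derivOn a b 2 s (gridNode a b n 2) = 0 :=
  h.moment_relation_of_isCubicOn hab hn (j := 0) (by omega) h.left_end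

theorem moment_relation_right (h : IsSplineInterpolant a b n x s) (hab : a < b) (hn : 4 ≤ n) :
    gridStep a b n ^ 2 * derivOn a b 2 s (gridNode a b n (n - 2)) =
        s (gridNode a b n (n - 1)) - 2 * s (gridNode a b n (n - 2)) + s (gridNode a b n (n - 3)) ∧
      derivOn a b 2 s (gridNode a b n (n - 3)) - 2 * derivOn a b 2 s (gridNode a b n (n - 2)) +
        derivOn a b 2 s (gridNode a b n (n - 1)) = 0 := by
  have e1 : n - 3 + 2 = n - 1 := by omega
  have e2 : n - 3 + 1 = n - 2 := by omega
  have := h.moment_relation_of_isCubicOn hab hn (j := n - 3) (by omega)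
    (by rw [e1]; exact h.right_end)
  rwa [e1, e2] at this

end IsSplineInterpolant

/-- Bounds for grid functions `E` which satisfy, up to errors, the equations for the second
derivatives of a not-a-knot spline. -/
theorem abs_le_of_moment_relations {n : ℕ} (hn : 4 ≤ n) {R R' : ℝ} {E : ℕ → ℝ}
    (h1 : |E 1| ≤ R) (hN : |E (n - 2)| ≤ R)
    (h : ∀ j, j + 2 < n → |E j + 4 * E (j + 1) + E (j + 2)| ≤ 2 * R)
    (hl : |E 0 - 2 * E 1 + E 2| ≤ R') (hr : |E (n - 3) - 2 * E (n - 2) + E (n - 1)| ≤ R')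
    {j : ℕ} (hj : j < n) : |E j| ≤ 3 * R + R' := by
  have hint : ∀ i, 1 ≤ i → i ≤ n - 2 → |E i| ≤ R := fun i h1' h2 =>
    abs_le_of_tridiagonal (N := n - 1) h1 hN (fun j _ h2 => h j (by omega)) h1' h2
  have hR : 0 ≤ R := (abs_nonneg _).trans h1
  have hR' : 0 ≤ R' := (abs_nonneg _).trans hl
  rcases Nat.eq_zero_or_pos j with rfl | hj0
  · have h2 := hint 2 (by omega) (by omega)
    rw [abs_le] at *
    constructor <;> linarith
  rcases eq_or_ne j (n - 1) with rfl | hjn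
  · have h2 := hint (n - 3) (by omega) (by omega)
    rw [abs_le] at *
    constructor <;> linarith
  · have := hint j hj0 (by omega)
    linarith

namespace IsSplineInterpolant

variable {a b : ℝ} {n : ℕ} {x : Fin n → ℝ} {s : ℝ → ℝ}

theorem abs_apply_gridNode_le (h : IsSplineInterpolant a b n x s) {j : ℕ} (hj : j < n) :
    |s (gridNode a b n j)| ≤ ‖x‖ := by
  have := h.interpolates ⟨j, hj⟩
  simp only at this
  rw [this]
  exact norm_le_pi_norm x ⟨j, hj⟩

theorem abs_second_deriv_gridNode_le (h : IsSplineInterpolant a b n x s) (hab : a < b) (hn : 4 ≤ n)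
    {j : ℕ} (hj : j < n) :
    |gridStep a b n ^ 2 * derivOn a b 2 s (gridNode a b n j)| ≤ 36 * ‖x‖ := by
  have hx : 0 ≤ ‖x‖ := norm_nonneg x
  have hd : ∀ i j k, i < n → j < n → k < n → |s (gridNode a b n i) - 2 * s (gridNode a b n j) +
      s (gridNode a b n k)| ≤ 4 * ‖x‖ := fun i j k hi hj hk => by
    have h1 := h.abs_apply_gridNode_le hi
    have h2 := h.abs_apply_gridNode_le hj
    have h3 := h.abs_apply_gridNode_le hk
    rw [abs_le] at *
    constructor <;> linarith
  have := abs_le_of_moment_relations (R := 12 * ‖x‖) (R' := 0) hn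
    (E := fun j => gridStep a b n ^ 2 * derivOn a b 2 s (gridNode a b n j)) ?_ ?_ ?_ ?_ ?_ hj
  · linarith
  · rw [(h.moment_relation_left hab hn).1]
    linarith [hd 2 1 0 (by omega) (by omega) (by omega)]
  · rw [(h.moment_relation_right hab hn).1]
    linarith [hd (n - 1) (n - 2) (n - 3) (by omega) (by omega) (by omega)]
  · intro j hj
    have e := h.moment_relation hab hn hj
    have := hd (j + 2) (j + 1) j (by omega) (by omega) (by omega)
    rw [abs_le] at *
    constructor <;> linarith
  · have e := (h.moment_relation_left hab hn).2
    rw [abs_nonpos_iff]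
    linear_combination gridStep a b n ^ 2 * e
  · have e := (h.moment_relation_right hab hn).2
    rw [abs_nonpos_iff]
    linear_combination gridStep a b n ^ 2 * e

/-- On a cell the second derivative is linear, hence bounded by its values at the nodes. More
generally this holds for the difference to a linear function. -/
theorem abs_second_deriv_sub_linear_le (h : IsSplineInterpolant a b n x s) (hab : a < b)
    (hn : 4 ≤ n) {j : ℕ} (hj : j + 1 < n) {A p q : ℝ}
    (h0 : |p - derivOn a b 2 s (gridNode a b n j)| ≤ A)
    (h1 : |p + q * gridStep a b n - derivOn a b 2 s (gridNode a b n (j + 1))| ≤ A) {t : ℝ}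
    (ht : t ∈ Icc (gridNode a b n j) (gridNode a b n (j + 1))) :
    |p + q * (t - gridNode a b n j) - derivOn a b 2 s t| ≤ A := by
  obtain ⟨c₀, c₁, c₂, c₃, H⟩ := h.exists_coeff_of_isCubicOn hab hn (Nat.lt_succ_self j) (by omega)
    (h.cubic j (by omega)) (gridNode a b n j)
  have hh := gridStep_pos hab hn
  have e1 : gridNode a b n (j + 1) = gridNode a b n j + gridStep a b n := by
    rw [gridNode_add]; simp
  rw [(H _ (gridNode_mem_cell hab hn le_rfl (by omega))).2.2] at h0
  rw [(H _ (gridNode_mem_cell hab hn (j := j + 1) (by omega) le_rfl)).2.2, e1] at h1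
  rw [(H t ht).2.2]
  rw [e1] at ht
  set w := t - gridNode a b n j with hw
  have hw0 : 0 ≤ w := sub_nonneg.2 ht.1
  have hw1 : w ≤ gridStep a b n := by linarith [ht.2]
  have hA : 0 ≤ A := (abs_nonneg _).trans h0
  -- a convex combination of the values at the two nodes
  obtain ⟨r, hr0, hr1, hr⟩ : ∃ r, 0 ≤ r ∧ r ≤ 1 ∧ w = r * gridStep a b n :=
    ⟨w / gridStep a b n, by positivity, (div_le_one hh).2 hw1, by field_simp⟩
  rw [hr]
  rw [sub_self, mul_zero, add_zero] at h0
  rw [show gridNode a b n j + gridStep a b n - gridNode a b n j = gridStep a b n by ring] at h1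
  have e : p + q * (r * gridStep a b n) - (2 * c₂ + 6 * c₃ * (r * gridStep a b n)) =
      (1 - r) * (p - 2 * c₂) +
        r * (p + q * gridStep a b n - (2 * c₂ + 6 * c₃ * gridStep a b n)) := by ring
  rw [e]
  refine (abs_add_le _ _).trans ?_
  rw [abs_mul, abs_mul, abs_of_nonneg hr0, abs_of_nonneg (sub_nonneg.2 hr1)]
  nlinarith [mul_le_mul_of_nonneg_left h0 (sub_nonneg.2 hr1), mul_le_mul_of_nonneg_left h1 hr0]

/-- Stability of cubic spline interpolation in the maximum norm. -/
theorem abs_le_norm (h : IsSplineInterpolant a b n x s) (hab : a < b) (hn : 4 ≤ n) {t : ℝ}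
    (ht : t ∈ Icc a b) : |s t| ≤ 39 * ‖x‖ := by
  obtain ⟨j, hj, htj⟩ := exists_mem_gridCell hn ht
  have hh := gridStep_pos hab hn
  have e1 : gridNode a b n (j + 1) = gridNode a b n j + gridStep a b n := by
    rw [gridNode_add]; simp
  have hM : ∀ i, i < n → |derivOn a b 2 s (gridNode a b n i)| ≤ 36 * ‖x‖ / gridStep a b n ^ 2 :=
    fun i hi => by
    have := h.abs_second_deriv_gridNode_le hab hn hi
    rw [abs_mul, abs_of_pos (by positivity)] at this
    rw [le_div_iff₀ (by positivity)]
    linarith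
  have hsub := Icc_gridNode_subset hab hn (show j < n by omega) hj
  have hB : ∀ t ∈ Icc (gridNode a b n j) (gridNode a b n (j + 1)),
      |derivOn a b 2 s t| ≤ 36 * ‖x‖ / gridStep a b n ^ 2 := fun t ht => by
    have := h.abs_second_deriv_sub_linear_le hab hn hj (p := 0) (q := 0)
      (by simpa using hM j (by omega)) (by simpa using hM (j + 1) hj) ht
    simpa using this
  have := (abs_le_of_second_deriv_le (by linarith : gridNode a b n j < gridNode a b n (j + 1))
    (e := s) (e₁ := derivOn a b 1 s) (fun t ht => by
      have := (hasDerivWithinAt_derivOn (k := 2) (m := 0) hab h.contDiffOn (by norm_num)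
        (hsub ht)).mono hsub
      rwa [derivOn_zero] at this)
    (fun t ht => (hasDerivWithinAt_derivOn (k := 2) (m := 1) hab h.contDiffOn (by norm_num)
        (hsub ht)).mono hsub)
    (h.abs_apply_gridNode_le (by omega)) (h.abs_apply_gridNode_le hj) hB htj).2
  rw [e1, add_sub_cancel_left, div_mul_cancel₀ _ (by positivity)] at this
  linarith

/-- The interpolation error of a `C⁴` function and its first two derivatives. The errors `E_j` of
the second derivatives at the nodes satisfy the equations of the spline with right-hand sides
`O(h² D)`, since these equations are exact for cubic polynomials; on each cell the error vanishes
at both nodes. -/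
theorem error_le {f : ℝ → ℝ} {D : ℝ} (hab : a < b) (hn : 4 ≤ n)
    (hf : ContDiffOn ℝ 4 f (Icc a b)) (hD : ∀ t ∈ Icc a b, |derivOn a b 4 f t| ≤ D)
    (h : IsSplineInterpolant a b n (fun j => f (gridNode a b n j)) s) {m : ℕ} (hm : m ≤ 2) {t : ℝ}
    (ht : t ∈ Icc a b) :
    |derivOn a b m f t - derivOn a b m s t| ≤ 630 * gridStep a b n ^ (4 - m) * D := by
  have hh := gridStep_pos hab hn
  have hD0 : 0 ≤ D := (abs_nonneg _).trans (hD a (left_mem_Icc.2 hab.le))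
  set η := gridStep a b n with hη
  have e1 : ∀ j, gridNode a b n (j + 1) = gridNode a b n j + η := fun j => by
    rw [gridNode_add]; simp [hη]
  have e2 : ∀ j, gridNode a b n (j + 2) = gridNode a b n j + 2 * η := fun j => by
    rw [gridNode_add]; simp [hη]
  have hval : ∀ j, j < n → s (gridNode a b n j) = f (gridNode a b n j) := fun j hj =>
    h.interpolates ⟨j, hj⟩
  have chain : ∀ k, k < 4 → ∀ t ∈ Icc a b,
      HasDerivWithinAt (derivOn a b k f) (derivOn a b (k + 1) f t) (Icc a b) t := fun k hk t ht =>
    hasDerivWithinAt_derivOn (k := 4) hab hf hk ht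
  have approx : ∀ i j, i < n → j < n → ∃ c₀ c₁ c₂ c₃ : ℝ,
      ∀ t ∈ Icc (gridNode a b n i) (gridNode a b n j),
      |f t - (c₀ + c₁ * (t - gridNode a b n i) + c₂ * (t - gridNode a b n i) ^ 2 +
          c₃ * (t - gridNode a b n i) ^ 3)| ≤
        D * (gridNode a b n j - gridNode a b n i) ^ 4 ∧
      |derivOn a b 2 f t - (2 * c₂ + 6 * c₃ * (t - gridNode a b n i))| ≤
        D * (gridNode a b n j - gridNode a b n i) ^ 2 := fun i j hi hj => by
    have hsub := Icc_gridNode_subset hab hn hi hj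
    refine exists_cubic_approx (f₁ := derivOn a b 1 f) (f₃ := derivOn a b 3 f)
      (f₄ := derivOn a b 4 f) (fun t ht => ?_)
      (fun t ht => (chain 1 (by norm_num) t (hsub ht)).mono hsub)
      (fun t ht => (chain 2 (by norm_num) t (hsub ht)).mono hsub)
      (fun t ht => (chain 3 (by norm_num) t (hsub ht)).mono hsub)
      (fun t ht => hD t (hsub ht))
    have := (chain 0 (by norm_num) t (hsub ht)).mono hsub
    rwa [derivOn_zero] at this
  set E : ℕ → ℝ := fun j => derivOn a b 2 f (gridNode a b n j) - derivOn a b 2 s (gridNode a b n j)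
    with hE
  -- consistency of the three kinds of equations on three consecutive nodes
  have cons : ∀ j, j + 2 < n →
      |η ^ 2 * (derivOn a b 2 f (gridNode a b n j) + 4 * derivOn a b 2 f (gridNode a b n (j + 1)) +
        derivOn a b 2 f (gridNode a b n (j + 2))) - 6 * (f (gridNode a b n (j + 2)) -
        2 * f (gridNode a b n (j + 1)) + f (gridNode a b n j))| ≤ 408 * (η ^ 2 * (η ^ 2 * D)) ∧
      |η ^ 2 * derivOn a b 2 f (gridNode a b n (j + 1)) - (f (gridNode a b n (j + 2)) -
        2 * f (gridNode a b n (j + 1)) + f (gridNode a b n j))| ≤ 68 * (η ^ 2 * (η ^ 2 * D)) ∧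
      |derivOn a b 2 f (gridNode a b n j) - 2 * derivOn a b 2 f (gridNode a b n (j + 1)) +
        derivOn a b 2 f (gridNode a b n (j + 2))| ≤ 16 * (η ^ 2 * D) := fun j hj => by
    obtain ⟨c₀, c₁, c₂, c₃, H⟩ := approx j (j + 2) (by omega) hj
    obtain ⟨p0, p2⟩ := H _ (gridNode_mem_cell hab hn (j := j) le_rfl (by omega))
    obtain ⟨q0, q2⟩ := H _ (gridNode_mem_cell hab hn (j := j + 1) (by omega) (by omega))
    obtain ⟨r0, r2⟩ := H _ (gridNode_mem_cell hab hn (j := j + 2) (by omega) le_rfl)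
    have d1 : gridNode a b n (j + 1) - gridNode a b n j = η := by rw [e1]; ring
    have d2 : gridNode a b n (j + 2) - gridNode a b n j = 2 * η := by rw [e2]; ring
    rw [sub_self, d2] at p0 p2
    rw [d1, d2] at q0 q2
    rw [d2] at r0 r2
    have f4 : D * (2 * η) ^ 4 = 16 * (η ^ 2 * (η ^ 2 * D)) := by ring
    have f2 : D * (2 * η) ^ 2 = 4 * (η ^ 2 * D) := by ring
    rw [f4] at p0 q0 r0
    rw [f2] at p2 q2 r2
    have mul2 : ∀ {y : ℝ}, |y| ≤ 4 * (η ^ 2 * D) → |η ^ 2 * y| ≤ 4 * (η ^ 2 * (η ^ 2 * D)) :=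
      fun {y} hy => by
      rw [abs_mul, abs_of_pos (by positivity : 0 < η ^ 2)]
      calc η ^ 2 * |y| ≤ η ^ 2 * (4 * (η ^ 2 * D)) := by gcongr
        _ = _ := by ring
    have p2' := mul2 p2
    have q2' := mul2 q2
    have r2' := mul2 r2
    rw [abs_le] at p0 q0 r0 p2 q2 r2 p2' q2' r2'
    refine ⟨abs_le.2 ⟨?_, ?_⟩, abs_le.2 ⟨?_, ?_⟩, abs_le.2 ⟨?_, ?_⟩⟩ <;> linarith
  have cancel : ∀ {y C : ℝ}, |η ^ 2 * y| ≤ C * (η ^ 2 * (η ^ 2 * D)) → |y| ≤ C * (η ^ 2 * D) :=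
    fun {y C} hy => by
    rw [abs_mul, abs_of_pos (by positivity : 0 < η ^ 2)] at hy
    refine le_of_mul_le_mul_left (hy.trans_eq ?_) (by positivity : 0 < η ^ 2)
    ring
  have e3 : n - 3 + 2 = n - 1 := by omega
  have e4 : n - 3 + 1 = n - 2 := by omega
  have hnode : ∀ j, j < n → |E j| ≤ 3 * (204 * (η ^ 2 * D)) + 16 * (η ^ 2 * D) := by
    have hpos : 0 ≤ η ^ 2 * D := by positivity
    intro j hj
    refine abs_le_of_moment_relations hn ?_ ?_ ?_ ?_ ?_ hj
    · have : |E 1| ≤ 68 * (η ^ 2 * D) := by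
        refine cancel ?_
        have h1 := (h.moment_relation_left hab hn).1
        rw [hval _ (by omega), hval _ (by omega), hval _ (by omega)] at h1
        have h2 := (cons 0 (by omega)).2.1
        simp only [hE, mul_sub]
        rw [h1]
        exact h2
      linarith
    · have : |E (n - 2)| ≤ 68 * (η ^ 2 * D) := by
        refine cancel ?_
        have h1 := (h.moment_relation_right hab hn).1
        rw [hval _ (by omega), hval _ (by omega), hval _ (by omega)] at h1
        have h2 := (cons (n - 3) (by omega)).2.1
        rw [e3, e4] at h2
        simp only [hE, mul_sub]
        rw [h1]
        exact h2
      linarith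
    · intro j hj
      have : |E j + 4 * E (j + 1) + E (j + 2)| ≤ 408 * (η ^ 2 * D) := by
        refine cancel ?_
        have h1 := h.moment_relation hab hn hj
        rw [hval _ (by omega), hval _ (by omega), hval _ (by omega)] at h1
        have h2 := (cons j hj).1
        rw [← h1] at h2
        convert h2 using 2
        simp only [hE]
        ring
      linarith
    · have h1 := (h.moment_relation_left hab hn).2
      have h2 := (cons 0 (by omega)).2.2
      convert h2 using 2
      simp only [hE]
      linear_combination -h1
    · have h1 := (h.moment_relation_right hab hn).2
      have h2 := (cons (n - 3) (by omega)).2.2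
      rw [e3, e4] at h2
      convert h2 using 2
      simp only [hE]
      linear_combination -h1
  obtain ⟨j, hj, htj⟩ := exists_mem_gridCell hn ht
  have hsub := Icc_gridNode_subset hab hn (show j < n by omega) hj
  have hB : ∀ t ∈ Icc (gridNode a b n j) (gridNode a b n (j + 1)),
      |derivOn a b 2 f t - derivOn a b 2 s t| ≤ 630 * (η ^ 2 * D) := fun t ht => by
    obtain ⟨c₀, c₁, c₂, c₃, H⟩ := approx j (j + 1) (by omega) hj
    have d1 : gridNode a b n (j + 1) - gridNode a b n j = η := by rw [e1]; ring
    have p2 := (H _ (gridNode_mem_cell hab hn (j := j) le_rfl (by omega))).2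
    have q2 := (H _ (gridNode_mem_cell hab hn (j := j + 1) (by omega) le_rfl)).2
    have t2 := (H _ ht).2
    rw [d1] at p2 q2 t2
    rw [sub_self] at p2
    have n0 := hnode j (by omega)
    have n1 := hnode (j + 1) hj
    simp only [hE] at n0 n1
    have hl := h.abs_second_deriv_sub_linear_le hab hn hj (A := 629 * (η ^ 2 * D)) (p := 2 * c₂)
      (q := 6 * c₃) (by rw [abs_le] at *; constructor <;> linarith)
      (by rw [← hη]; rw [abs_le] at *; constructor <;> linarith) ht
    rw [abs_le] at *
    constructor <;> linarith
  have := abs_le_of_second_deriv_le (A := 0)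
    (by rw [e1]; linarith : gridNode a b n j < gridNode a b n (j + 1))
    (e := fun t => f t - s t) (e₁ := fun t => derivOn a b 1 f t - derivOn a b 1 s t)
    (fun t ht => by
      have h1 := (chain 0 (by norm_num) t (hsub ht)).mono hsub
      have h2 := (hasDerivWithinAt_derivOn (k := 2) (m := 0) hab h.contDiffOn (by norm_num)
        (hsub ht)).mono hsub
      rw [derivOn_zero] at h1 h2
      exact h1.fun_sub h2)
    (fun t ht => ((chain 1 (by norm_num) t (hsub ht)).mono hsub).fun_sub
      ((hasDerivWithinAt_derivOn (k := 2) (m := 1) hab h.contDiffOn (by norm_num)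
        (hsub ht)).mono hsub))
    (by rw [hval j (by omega)]; simp) (by rw [hval _ hj]; simp) hB htj
  rw [e1, add_sub_cancel_left] at this
  interval_cases m
  · rw [derivOn_zero, derivOn_zero]
    refine this.2.trans_eq ?_
    ring
  · refine this.1.trans_eq ?_
    ring
  · refine (hB t htj).trans_eq ?_
    ring

end IsSplineInterpolant

/-! ### Existence and uniqueness of the spline interpolant -/

theorem hasDerivAt_max_zero_pow (k : ℕ) (t : ℝ) :
    HasDerivAt (fun t : ℝ => max 0 t ^ (k + 2)) ((k + 2) * max 0 t ^ (k + 1)) t := by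
  rcases lt_trichotomy t 0 with ht | rfl | ht
  · rw [max_eq_left ht.le, zero_pow (by omega), mul_zero]
    refine (hasDerivAt_const t (0 : ℝ)).congr_of_eventuallyEq ?_
    filter_upwards [Iio_mem_nhds ht] with y hy
    rw [max_eq_left (le_of_lt hy), zero_pow (by omega)]
  · rw [max_self, zero_pow (by omega), mul_zero, hasDerivAt_iff_isLittleO]
    have h1 : (fun t : ℝ => max 0 t ^ (k + 2)) =O[nhds 0] fun t : ℝ => t ^ (k + 2) := by
      refine Asymptotics.IsBigO.of_bound 1 (.of_forall fun t => ?_)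
      rw [one_mul, norm_pow, norm_pow]
      refine pow_le_pow_left₀ (norm_nonneg _) ?_ _
      rw [Real.norm_eq_abs, Real.norm_eq_abs, abs_of_nonneg (le_max_left _ _)]
      exact max_le (abs_nonneg _) (le_abs_self _)
    have h2 : (fun t : ℝ => t ^ (k + 2)) =o[nhds 0] fun t : ℝ => t := by
      simpa using Asymptotics.isLittleO_pow_pow (𝕜 := ℝ) (show 1 < k + 2 by omega)
    simpa using h1.trans_isLittleO h2
  · rw [max_eq_right ht.le]
    have := hasDerivAt_pow (k + 2) t
    refine (this.congr_deriv (by push_cast; simp)).congr_of_eventuallyEq ?_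
    filter_upwards [Ioi_mem_nhds ht] with y hy
    rw [max_eq_right (le_of_lt hy)]

theorem contDiff_max_zero_cube : ContDiff ℝ 2 fun t : ℝ => max 0 t ^ 3 := by
  have h1 : deriv (fun t : ℝ => max 0 t ^ 3) = fun t => 3 * max 0 t ^ 2 := by
    funext t
    rw [(hasDerivAt_max_zero_pow 1 t).deriv]
    norm_num
  have h2 : deriv (fun t : ℝ => 3 * max 0 t ^ 2) = fun t => 6 * max 0 t := by
    funext t
    have := ((hasDerivAt_max_zero_pow 0 t).const_mul 3).deriv
    simp only [zero_add] at this
    rw [this]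
    push_cast
    ring
  rw [show (2 : WithTop ℕ∞) = 1 + 1 by norm_num, contDiff_succ_iff_deriv]
  refine ⟨fun t => (hasDerivAt_max_zero_pow 1 t).differentiableAt, by simp, ?_⟩
  rw [h1, contDiff_one_iff_deriv]
  refine ⟨fun t => ((hasDerivAt_max_zero_pow 0 t).const_mul 3).differentiableAt, ?_⟩
  rw [h2]
  fun_prop

/-- The spline with coefficients `c` of its cubic polynomial on the left and `d` of the truncated
cubes `(t - θ_{k+2})₊³`, where `θ_2, …, θ_{n-3}` are the nodes at which the third derivative may
jump. -/
noncomputable def truncatedPowerSpline (a b : ℝ) (n : ℕ) (c : Fin 4 → ℝ) (d : Fin (n - 4) → ℝ)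
    (t : ℝ) : ℝ :=
  ∑ i : Fin 4, c i * (t - a) ^ (i : ℕ) +
    ∑ k : Fin (n - 4), d k * max 0 (t - gridNode a b n (k + 2)) ^ 3

theorem isCubicOn_truncatedPowerSpline {a b : ℝ} {n : ℕ} (c : Fin 4 → ℝ) (d : Fin (n - 4) → ℝ)
    {u v : ℝ} (h : ∀ k : Fin (n - 4), v ≤ gridNode a b n (k + 2) ∨ gridNode a b n (k + 2) ≤ u) :
    IsCubicOn (truncatedPowerSpline a b n c d) u v := by
  have hsum : ∀ S : Finset (Fin (n - 4)), IsCubicOn (fun t => ∑ i : Fin 4, c i * (t - a) ^ (i : ℕ) +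
      ∑ k ∈ S, d k * max 0 (t - gridNode a b n (k + 2)) ^ 3) u v := by
    classical
    intro S
    induction S using Finset.induction_on with
    | empty =>
      refine (isCubicOn_iff a).2 ⟨c 0, c 1, c 2, c 3, fun t _ => ?_⟩
      simp [Fin.sum_univ_four]
    | insert k S hk ih =>
      have h1 : IsCubicOn (fun t => max 0 (t - gridNode a b n (k + 2)) ^ 3) u v := by
        rcases h k with h | h
        · refine (isCubicOn_iff 0).2 ⟨0, 0, 0, 0, fun t ht => ?_⟩
          rw [max_eq_left (by linarith [ht.2])]
          simp
        · refine (isCubicOn_iff (gridNode a b n (k + 2))).2 ⟨0, 0, 0, 1, fun t ht => ?_⟩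
          rw [max_eq_right (by linarith [ht.1])]
          simp
      have := ih.linear_comb h1 (d k)
      convert this using 2 with t
      rw [Finset.sum_insert hk]
      ring
  exact hsum Finset.univ

theorem isSplineInterpolant_truncatedPowerSpline {a b : ℝ} {n : ℕ} (hab : a < b) (hn : 4 ≤ n)
    (c : Fin 4 → ℝ) (d : Fin (n - 4) → ℝ) :
    IsSplineInterpolant a b n (fun j => truncatedPowerSpline a b n c d (gridNode a b n j))
      (truncatedPowerSpline a b n c d) where
  contDiffOn := by
    refine ContDiff.contDiffOn ?_
    refine ContDiff.add (by fun_prop) (ContDiff.sum fun k _ => contDiff_const.mul ?_)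
    exact contDiff_max_zero_cube.comp (contDiff_id.sub contDiff_const)
  interpolates _ := rfl
  cubic j hj := isCubicOn_truncatedPowerSpline c d fun k => by
    rcases le_or_gt (j + 1) (k + 2) with h | h
    · exact Or.inl (gridNode_mono hab hn h)
    · exact Or.inr (gridNode_mono hab hn (by omega))
  left_end := isCubicOn_truncatedPowerSpline c d fun k =>
    Or.inl (gridNode_mono hab hn (by omega))
  right_end := isCubicOn_truncatedPowerSpline c d fun k =>
    Or.inr (gridNode_mono hab hn (by omega))

theorem truncatedPowerSpline_eq_zero {a b : ℝ} {n : ℕ} (hab : a < b) (hn : 4 ≤ n) {c : Fin 4 → ℝ}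
    {d : Fin (n - 4) → ℝ}
    (h : ∀ j : Fin n, truncatedPowerSpline a b n c d (gridNode a b n j) = 0) : c = 0 ∧ d = 0 := by
  have hh := gridStep_pos hab hn
  have hs : ∀ t ∈ Icc a b, truncatedPowerSpline a b n c d t = 0 := fun t ht => by
    have := (isSplineInterpolant_truncatedPowerSpline hab hn c d).abs_le_norm hab hn ht
    rw [show (fun j : Fin n => truncatedPowerSpline a b n c d (gridNode a b n j)) = 0 from
      funext h, norm_zero, mul_zero] at this
    exact abs_nonpos_iff.1 this
  have hc : c = 0 := by
    have hpoly : ∀ u : ℝ, 0 ≤ u → u ≤ 2 → c 0 + c 1 * gridStep a b n * u +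
        c 2 * gridStep a b n ^ 2 * u ^ 2 + c 3 * gridStep a b n ^ 3 * u ^ 3 = 0 := by
      intro u hu0 hu2
      have hm2 : a + u * gridStep a b n ≤ gridNode a b n 2 := by
        rw [gridNode_eq]
        push_cast
        gcongr
      have hmem : a + u * gridStep a b n ∈ Icc a b :=
        ⟨by have := mul_nonneg hu0 hh.le; linarith,
          hm2.trans (gridNode_mem hab hn (by omega)).2⟩
      have := hs _ hmem
      rw [truncatedPowerSpline, Finset.sum_eq_zero (s := (Finset.univ : Finset (Fin (n - 4)))),
        Fin.sum_univ_four] at this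
      · simp at this
        linear_combination this
      · intro k _
        rw [max_eq_left, zero_pow (by norm_num), mul_zero]
        have := gridNode_mono hab hn (show 2 ≤ (k : ℕ) + 2 by omega)
        linarith
    have h0 := hpoly 0 (by norm_num) (by norm_num)
    have h1 := hpoly 1 (by norm_num) (by norm_num)
    have h2 := hpoly 2 (by norm_num) (by norm_num)
    have h3 := hpoly (1 / 2) (by norm_num) (by norm_num)
    have c1 : c 1 * gridStep a b n = 0 := by linarith
    have c2 : c 2 * gridStep a b n ^ 2 = 0 := by linarith
    have c3 : c 3 * gridStep a b n ^ 3 = 0 := by linarith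
    funext i
    fin_cases i
    · simpa using h0
    · simpa [hh.ne'] using c1
    · simpa [hh.ne'] using c2
    · simpa [hh.ne'] using c3
  refine ⟨hc, ?_⟩
  -- the truncated cubes are removed one after the other, by evaluation at the node after the knot
  have hd : ∀ k : ℕ, ∀ hk : k < n - 4, d ⟨k, hk⟩ = 0 := by
    intro k
    induction k using Nat.strong_induction_on with
    | _ k ih =>
      intro hk
      have := h ⟨k + 3, by omega⟩
      rw [truncatedPowerSpline, hc, Finset.sum_eq_single (⟨k, hk⟩ : Fin (n - 4))] at this
      · rw [show ((⟨k + 3, by omega⟩ : Fin n) : ℕ) = (k + 2) + 1 from rfl, gridNode_add] at this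
        simp only [Pi.zero_apply, zero_mul, Finset.sum_const_zero, zero_add, Nat.cast_one, one_mul,
          add_sub_cancel_left, max_eq_right hh.le] at this
        simpa [hh.ne'] using this
      · intro i _ hi
        rcases lt_or_gt_of_ne (fun h => hi (Fin.ext h) : (i : ℕ) ≠ k) with h | h
        · rw [ih i h i.2, zero_mul]
        · have := gridNode_mono hab hn (show k + 3 ≤ (i : ℕ) + 2 by omega)
          rw [max_eq_left (by simpa using this), zero_pow (by norm_num), mul_zero]
      · simp
  funext k
  exact hd k k.2

/-- Interpolation by truncated power splines is an injective linear map between spaces of the same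
dimension `n`. -/
theorem exists_isSplineInterpolant {a b : ℝ} {n : ℕ} (hab : a < b) (hn : 4 ≤ n) (x : Fin n → ℝ) :
    ∃ s, IsSplineInterpolant a b n x s := by
  let T : ((Fin 4 → ℝ) × (Fin (n - 4) → ℝ)) →ₗ[ℝ] (Fin n → ℝ) :=
    { toFun := fun p j => truncatedPowerSpline a b n p.1 p.2 (gridNode a b n j)
      map_add' := fun p q => by
        funext j
        simp only [truncatedPowerSpline, Prod.fst_add, Prod.snd_add, Pi.add_apply, add_mul,
          Finset.sum_add_distrib]
        ring
      map_smul' := fun r p => by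
        funext j
        simp only [truncatedPowerSpline, Prod.smul_fst, Prod.smul_snd, Pi.smul_apply, smul_eq_mul,
          mul_assoc, ← Finset.mul_sum, RingHom.id_apply]
        ring }
  have hinj : Function.Injective T := by
    rw [injective_iff_map_eq_zero]
    intro p hp
    have := truncatedPowerSpline_eq_zero hab hn (fun j => congrFun hp j)
    exact Prod.ext this.1 this.2
  have hsurj : Function.Surjective T := by
    refine (LinearMap.injective_iff_surjective_of_finrank_eq_finrank ?_).1 hinj
    simp
    omega
  obtain ⟨p, hp⟩ := hsurj x
  refine ⟨truncatedPowerSpline a b n p.1 p.2, ?_⟩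
  rw [← hp]
  exact isSplineInterpolant_truncatedPowerSpline hab hn p.1 p.2

theorem isSplineInterpolant_splineInterp {a b : ℝ} {n : ℕ} (hab : a < b) (hn : 4 ≤ n)
    (x : Fin n → ℝ) : IsSplineInterpolant a b n x (splineInterp a b n x) := by
  have h := exists_isSplineInterpolant hab hn x
  rw [splineInterp, dif_pos h]
  exact h.choose_spec

/-- Linearity of spline interpolation on `[a, b]`, a consequence of uniqueness. -/
theorem splineInterp_sub {a b : ℝ} {n : ℕ} (hab : a < b) (hn : 4 ≤ n) (x y : Fin n → ℝ) :
    EqOn (splineInterp a b n (x - y)) (splineInterp a b n x - splineInterp a b n y) (Icc a b) := by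
  intro t ht
  have h1 := (isSplineInterpolant_splineInterp hab hn x).linear_comb
    (isSplineInterpolant_splineInterp hab hn y) (-1)
  have h2 := h1.linear_comb (isSplineInterpolant_splineInterp hab hn (x - y)) (-1)
  have h3 := h2.abs_le_norm hab hn ht
  have e : (fun j => x j + -1 * y j + -1 * (x - y) j) = 0 := by
    funext j
    simp only [Pi.sub_apply, Pi.zero_apply]
    ring
  rw [e, norm_zero, mul_zero, abs_nonpos_iff] at h3
  rw [Pi.sub_apply]
  linarith

theorem derivOn_splineInterp_sub {a b : ℝ} {n : ℕ} (hab : a < b) (hn : 4 ≤ n) (x y : Fin n → ℝ)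
    {m : ℕ} (hm : m ≤ 2) {t : ℝ} (ht : t ∈ Icc a b) :
    derivOn a b m (splineInterp a b n (x - y)) t =
      derivOn a b m (splineInterp a b n x) t - derivOn a b m (splineInterp a b n y) t := by
  have hm' : (m : WithTop ℕ∞) ≤ 2 := by exact_mod_cast hm
  rw [derivOn, iteratedDerivWithin_congr (splineInterp_sub hab hn x y) ht,
    iteratedDerivWithin_sub ht (uniqueDiffOn_Icc hab)
      (((isSplineInterpolant_splineInterp hab hn x).contDiffOn.of_le hm') t ht)
      (((isSplineInterpolant_splineInterp hab hn y).contDiffOn.of_le hm') t ht)]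
  rfl

/-! ### The constants of spline interpolation -/

/-- The inverse inequality: the coefficients of a cubic on a cell are bounded by its values at four
equally spaced points. -/
theorem IsSplineInterpolant.abs_derivOn_le {a b S : ℝ} {n : ℕ} {x : Fin n → ℝ} {s : ℝ → ℝ}
    (h : IsSplineInterpolant a b n x s) (hab : a < b) (hn : 4 ≤ n)
    (hS : ∀ t ∈ Icc a b, |s t| ≤ S) {m : ℕ} (hm : m ≤ 2) {t : ℝ} (ht : t ∈ Icc a b) :
    |derivOn a b m s t| ≤ 324 * S / gridStep a b n ^ m := by
  have hh := gridStep_pos hab hn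
  have hS0 : 0 ≤ S := (abs_nonneg _).trans (hS t ht)
  obtain ⟨j, hj, htj⟩ := exists_mem_gridCell hn ht
  obtain ⟨c₀, c₁, c₂, c₃, H⟩ := h.exists_coeff_of_isCubicOn hab hn (Nat.lt_succ_self j) (by omega)
    (h.cubic j (by omega)) (gridNode a b n j)
  have hsub := Icc_gridNode_subset hab hn (show j < n by omega) hj
  have e1 : gridNode a b n (j + 1) = gridNode a b n j + gridStep a b n := by
    rw [gridNode_add]; simp
  have hv : ∀ u : ℝ, 0 ≤ u → u ≤ 1 → |c₀ + c₁ * gridStep a b n * u +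
      c₂ * gridStep a b n ^ 2 * u ^ 2 + c₃ * gridStep a b n ^ 3 * u ^ 3| ≤ S := by
    intro u hu0 hu1
    have hmem : gridNode a b n j + u * gridStep a b n ∈
        Icc (gridNode a b n j) (gridNode a b n (j + 1)) := by
      rw [e1]
      constructor <;> nlinarith
    have := hS _ (hsub hmem)
    rw [(H _ hmem).1, add_sub_cancel_left] at this
    convert this using 2
    ring
  have v0 := hv 0 (by norm_num) (by norm_num)
  have v1 := hv (1 / 3) (by norm_num) (by norm_num)
  have v2 := hv (2 / 3) (by norm_num) (by norm_num)
  have v3 := hv 1 (by norm_num) (by norm_num)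
  rw [abs_le] at v0 v1 v2 v3
  have b1 : |c₁ * gridStep a b n| ≤ 20 * S := abs_le.2 (by constructor <;> linarith)
  have b2 : |c₂ * gridStep a b n ^ 2| ≤ 54 * S := abs_le.2 (by constructor <;> linarith)
  have b3 : |c₃ * gridStep a b n ^ 3| ≤ 36 * S := abs_le.2 (by constructor <;> linarith)
  rw [e1] at htj
  obtain ⟨r, hr0, hr1, hr⟩ : ∃ r, 0 ≤ r ∧ r ≤ 1 ∧ t - gridNode a b n j = r * gridStep a b n :=
    ⟨(t - gridNode a b n j) / gridStep a b n, div_nonneg (by linarith [htj.1]) hh.le,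
      (div_le_one hh).2 (by linarith [htj.2]), by field_simp⟩
  have Ht := H t (by rw [e1]; exact htj)
  rw [hr] at Ht
  have hmul : ∀ {y B : ℝ} (q : ℝ), 0 ≤ q → q ≤ 1 → |y| ≤ B → |y * q| ≤ B := fun q hq0 hq1 hy => by
    rw [abs_mul, abs_of_nonneg hq0]
    exact (mul_le_of_le_one_right (abs_nonneg _) hq1).trans hy
  rw [le_div_iff₀ (by positivity)]
  have hr2 : r ^ 2 ≤ 1 := pow_le_one₀ hr0 hr1
  interval_cases m
  · rw [derivOn_zero]
    have := hS t ht
    simp only [pow_zero, mul_one]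
    linarith
  · have m2 := hmul r hr0 hr1 b2
    have m3 := hmul (r ^ 2) (by positivity) hr2 b3
    have e : |derivOn a b 1 s t| * gridStep a b n ^ 1 = |c₁ * gridStep a b n +
        2 * (c₂ * gridStep a b n ^ 2 * r) + 3 * (c₃ * gridStep a b n ^ 3 * r ^ 2)| := by
      rw [← abs_of_pos (by positivity : 0 < gridStep a b n ^ 1), ← abs_mul, Ht.2.1]
      congr 1
      ring
    rw [e]
    rw [abs_le] at *
    constructor <;> linarith
  · have m3 := hmul r hr0 hr1 b3
    have e : |derivOn a b 2 s t| * gridStep a b n ^ 2 = |2 * (c₂ * gridStep a b n ^ 2) +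
        6 * (c₃ * gridStep a b n ^ 3 * r)| := by
      rw [← abs_of_pos (by positivity : 0 < gridStep a b n ^ 2), ← abs_mul, Ht.2.2,
        abs_of_pos (by positivity : 0 < gridStep a b n ^ 2)]
      congr 1
      ring
    rw [e]
    rw [abs_le] at *
    constructor <;> linarith

theorem isSplineConstants {a b : ℝ} (hab : a < b) :
    IsSplineConstants a b (fun _ => 2000) (fun m => 324 / (b - a) ^ m) 39 where
  pos₁ _ _ := by norm_num
  pos₂ _ _ := by have := sub_pos.2 hab; positivity
  pos₃ := by norm_num
  interp_error n hn f hf m hm := by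
    have hcont := continuousOn_derivOn (m := 4) hab hf le_rfl
    have hs := isSplineInterpolant_splineInterp hab hn (fun j => f (gridNode a b n j))
    have hba := sub_pos.2 hab
    have hn' := natCast_sub_one_pos hn
    have hn4 : (4 : ℝ) ≤ n := by exact_mod_cast hn
    rw [← ENNReal.ofReal_toReal (supNorm_ne_top hcont), ← ENNReal.ofReal_mul (by positivity)]
    refine supNorm_le_of_forall fun t ht => ?_
    refine (hs.error_le hab hn hf (fun t ht => abs_le_toReal_supNorm hab hcont ht) hm ht).trans ?_
    have hstep : gridStep a b n ≤ 4 / 3 * ((b - a) / n) := by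
      rw [gridStep, div_le_iff₀ hn']
      have : 4 / 3 * ((b - a) / n) * ((n : ℝ) - 1) = (b - a) * (4 / 3 * (n - 1) / n) := by ring
      rw [this]
      refine le_mul_of_one_le_right hba.le ?_
      rw [le_div_iff₀ (by linarith)]
      linarith
    refine mul_le_mul_of_nonneg_right ?_ ENNReal.toReal_nonneg
    calc 630 * gridStep a b n ^ (4 - m) ≤ 630 * (4 / 3 * ((b - a) / n)) ^ (4 - m) := by
          have := (gridStep_pos hab hn).le
          gcongr
      _ = 630 * (4 / 3) ^ (4 - m) * ((b - a) / n) ^ (4 - m) := by rw [mul_pow]; ring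
      _ ≤ 2000 * ((b - a) / n) ^ (4 - m) := by
          gcongr
          interval_cases m <;> norm_num
  inverse n hn x m hm := by
    have hs := isSplineInterpolant_splineInterp hab hn x
    have hcont : ContinuousOn (splineInterp a b n x) (Icc a b) := hs.contDiffOn.continuousOn
    have hba := sub_pos.2 hab
    have hn' := natCast_sub_one_pos hn
    rw [← ENNReal.ofReal_toReal (supNorm_ne_top hcont), ← ENNReal.ofReal_mul (by positivity)]
    refine supNorm_le_of_forall fun t ht => ?_
    refine (hs.abs_derivOn_le hab hn (fun t ht => abs_le_toReal_supNorm hab hcont ht) hm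
      ht).trans_eq ?_
    rw [gridStep, div_pow]
    field_simp
  stable n hn x := supNorm_le_of_forall fun t ht =>
    (isSplineInterpolant_splineInterp hab hn x).abs_le_norm hab hn ht

/-! ### The cost of the tuned estimator -/

theorem sum_exp_mul_le {δ : ℝ} (hδ : 0 < δ) (L : ℕ) :
    ∑ l ∈ Finset.range (L + 1), Real.exp (δ * l) ≤
      Real.exp δ / (Real.exp δ - 1) * Real.exp (δ * L) := by
  have h1 : 1 < Real.exp δ := Real.one_lt_exp_iff.2 hδ
  have h0 : 0 < Real.exp δ - 1 := sub_pos.2 h1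
  have e : ∀ l : ℕ, Real.exp (δ * l) = Real.exp δ ^ l := fun l => by
    rw [← Real.exp_nat_mul, mul_comm]
  simp only [e]
  rw [geom_sum_eq h1.ne', div_mul_eq_mul_div]
  refine div_le_div_of_nonneg_right ?_ h0.le
  rw [pow_succ']
  linarith

theorem sum_exp_neg_mul_le {δ : ℝ} (hδ : 0 < δ) (L : ℕ) :
    ∑ l ∈ Finset.range (L + 1), Real.exp (-δ * l) ≤ (1 - Real.exp (-δ))⁻¹ := by
  have h1 : Real.exp (-δ) < 1 := Real.exp_lt_one_iff.2 (by linarith)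
  have e : ∀ l : ℕ, Real.exp (-δ * l) = Real.exp (-δ) ^ l := fun l => by
    rw [← Real.exp_nat_mul, mul_comm]
  simp only [e]
  rw [← tsum_geometric_of_lt_one (Real.exp_pos _).le h1]
  exact (summable_geometric_of_lt_one (Real.exp_pos _).le h1).sum_le_tsum _
    fun _ _ => by positivity

theorem one_le_log_inv {ε : ℝ} (hε : 0 < ε) (hε1 : ε < Real.exp (-1)) : 1 ≤ Real.log ε⁻¹ := by
  rw [Real.log_inv]
  have := Real.log_lt_log hε hε1
  rw [Real.log_exp] at this
  linarith

theorem le_one_of_lt_exp_neg_one {ε : ℝ} (hε1 : ε < Real.exp (-1)) : ε ≤ 1 :=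
  hε1.le.trans (Real.exp_le_one_iff.2 (by norm_num))

theorem one_le_rpow_neg {ε x : ℝ} (hε : 0 < ε) (hε1 : ε ≤ 1) (hx : 0 ≤ x) : 1 ≤ ε ^ (-x) :=
  Real.one_le_rpow_of_pos_of_le_one_of_nonpos hε hε1 (by linarith)

/-- If `e^{αL} ≤ κ ε^{-q}`, then `e^{δL}` is at most a power of `ε` with exponent `-q δ / α`. -/
theorem exp_mul_le_rpow {α δ κ q ε : ℝ} (hα : 0 < α) (hδ : 0 ≤ δ) (hκ : 0 < κ) (hε : 0 < ε) {L : ℕ}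
    (h : Real.exp (α * L) ≤ κ * ε ^ (-q)) :
    Real.exp (δ * L) ≤ κ ^ (δ / α) * ε ^ (-(q * (δ / α))) := by
  have e : Real.exp (δ * L) = Real.exp (α * L) ^ (δ / α) := by
    rw [← Real.exp_mul]
    congr 1
    field_simp
  rw [e]
  calc Real.exp (α * L) ^ (δ / α) ≤ (κ * ε ^ (-q)) ^ (δ / α) :=
        Real.rpow_le_rpow (Real.exp_pos _).le h (by positivity)
    _ = _ := by
        rw [Real.mul_rpow hκ.le (by positivity), ← Real.rpow_mul hε.le]
        congr 2
        ring

theorem rateFactor_pos {α β γ : ℝ} {m : ℕ} {ε : ℝ} (hε : 0 < ε) (hε1 : ε < Real.exp (-1)) :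
    0 < rateFactor α β γ m ε := by
  have := one_le_log_inv hε hε1
  unfold rateFactor
  split_ifs <;> positivity

section Rates

variable {α β γ κ : ℝ} {m : ℕ}

theorem succ_le_log_inv (hα : 0 < α) (hm : m ≤ 2) (hκ : 0 < κ) :
    ∃ K, 0 < K ∧ ∀ ε : ℝ, 0 < ε → ε < Real.exp (-1) → ∀ L : ℕ,
      Real.exp (α * L) ≤ κ * ε ^ (-(4 / (4 - (m : ℝ)))) → (L : ℝ) + 1 ≤ K * Real.log ε⁻¹ := by
  have hm' : (m : ℝ) ≤ 2 := by exact_mod_cast hm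
  refine ⟨(|Real.log κ| + 2) / α + 1, by positivity, fun ε hε hε1 L h => ?_⟩
  have hl := one_le_log_inv hε hε1
  have h1 := Real.log_le_log (Real.exp_pos _) h
  rw [Real.log_exp, Real.log_mul hκ.ne' (by positivity), Real.log_rpow hε] at h1
  have hq : 4 / (4 - (m : ℝ)) ≤ 2 := by
    rw [div_le_iff₀ (by linarith)]
    linarith
  have h2 : -(4 / (4 - (m : ℝ))) * Real.log ε ≤ 2 * Real.log ε⁻¹ := by
    rw [neg_mul, ← mul_neg, ← Real.log_inv]
    gcongr
  have h3 : α * L ≤ (|Real.log κ| + 2) * Real.log ε⁻¹ := by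
    have := le_abs_self (Real.log κ)
    nlinarith [abs_nonneg (Real.log κ)]
  have h4 : (L : ℝ) ≤ (|Real.log κ| + 2) / α * Real.log ε⁻¹ := by
    rw [div_mul_eq_mul_div, le_div_iff₀ hα]
    linarith
  linarith

theorem sq_sum_exp_le_rateFactor (hα : 0 < α) (hm : m ≤ 2) (hκ : 0 < κ) :
    ∃ K, 0 < K ∧ ∀ ε : ℝ, 0 < ε → ε < Real.exp (-1) → ∀ L : ℕ,
      Real.exp (α * L) ≤ κ * ε ^ (-(4 / (4 - (m : ℝ)))) →
      (∑ l ∈ Finset.range (L + 1), Real.exp ((γ - β) / 2 * l)) ^ 2 ≤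
        K * rateFactor α β γ m ε := by
  rcases lt_trichotomy γ β with hlt | heq | hgt
  · have h1 : Real.exp (-((β - γ) / 2)) < 1 := Real.exp_lt_one_iff.2 (by linarith)
    have h0 : 0 < 1 - Real.exp (-((β - γ) / 2)) := sub_pos.2 h1
    refine ⟨(1 - Real.exp (-((β - γ) / 2)))⁻¹ ^ 2, by positivity, fun ε hε hε1 L _ => ?_⟩
    rw [rateFactor, if_pos hlt, mul_one]
    refine pow_le_pow_left₀ (Finset.sum_nonneg fun _ _ => (Real.exp_pos _).le) ?_ 2
    have := sum_exp_neg_mul_le (show 0 < (β - γ) / 2 by linarith) L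
    rwa [show -((β - γ) / 2) = (γ - β) / 2 by ring] at this ⊢
  · obtain ⟨K, hK, H⟩ := succ_le_log_inv hα hm hκ
    refine ⟨K ^ 2, by positivity, fun ε hε hε1 L h => ?_⟩
    rw [rateFactor, if_neg (by linarith), if_pos heq.symm, ← mul_pow]
    refine pow_le_pow_left₀ (Finset.sum_nonneg fun _ _ => (Real.exp_pos _).le) ?_ 2
    simpa [heq] using H ε hε hε1 L h
  · have h1 : 1 < Real.exp ((γ - β) / 2) := Real.one_lt_exp_iff.2 (by linarith)
    have h0 : 0 < Real.exp ((γ - β) / 2) - 1 := sub_pos.2 h1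
    refine ⟨(Real.exp ((γ - β) / 2) / (Real.exp ((γ - β) / 2) - 1)) ^ 2 * κ ^ ((γ - β) / α),
      by positivity, fun ε hε hε1 L h => ?_⟩
    rw [rateFactor, if_neg (by linarith), if_neg (by linarith)]
    have h2 := sum_exp_mul_le (show 0 < (γ - β) / 2 by linarith) L
    have h3 := exp_mul_le_rpow hα (show 0 ≤ γ - β by linarith) hκ hε h
    calc _ ≤ (Real.exp ((γ - β) / 2) / (Real.exp ((γ - β) / 2) - 1) *
          Real.exp ((γ - β) / 2 * L)) ^ 2 :=
          pow_le_pow_left₀ (Finset.sum_nonneg fun _ _ => (Real.exp_pos _).le) h2 2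
      _ = (Real.exp ((γ - β) / 2) / (Real.exp ((γ - β) / 2) - 1)) ^ 2 *
          Real.exp ((γ - β) * L) := by
          rw [mul_pow, ← Real.exp_nat_mul]
          congr 2
          push_cast
          ring
      _ ≤ _ := by
          rw [mul_assoc]
          refine mul_le_mul_of_nonneg_left (h3.trans_eq ?_) (by positivity)
          congr 2
          ring

/-- The cost of one sample per level; here the condition `2α ≥ min(β, γ)` enters. -/
theorem sum_exp_le_rateFactor (hα : 0 < α) (hγ : 0 < γ) (hmin : min β γ ≤ 2 * α)
    (hm : m ≤ 2) (hκ : 0 < κ) :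
    ∃ K, 0 < K ∧ ∀ ε : ℝ, 0 < ε → ε < Real.exp (-1) → ∀ L : ℕ,
      Real.exp (α * L) ≤ κ * ε ^ (-(4 / (4 - (m : ℝ)))) →
      ∑ l ∈ Finset.range (L + 1), Real.exp (γ * l) ≤
        K * (ε ^ (-2 - 2 * (m : ℝ) / (4 - (m : ℝ))) * rateFactor α β γ m ε) := by
  have hm' : (m : ℝ) ≤ 2 := by exact_mod_cast hm
  have hp : 0 < 4 - (m : ℝ) := by linarith
  have h1 : 1 < Real.exp γ := Real.one_lt_exp_iff.2 hγ
  have h0 : 0 < Real.exp γ - 1 := sub_pos.2 h1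
  refine ⟨Real.exp γ / (Real.exp γ - 1) * κ ^ (γ / α), by positivity, fun ε hε hε1 L h => ?_⟩
  have hε1' := le_one_of_lt_exp_neg_one hε1
  have hl := one_le_log_inv hε hε1
  have h3 := exp_mul_le_rpow hα hγ.le hκ hε h
  have hexp : -2 - 2 * (m : ℝ) / (4 - (m : ℝ)) = -(4 / (4 - (m : ℝ)) * 2) := by
    field_simp
    ring
  have hq : 0 < 4 / (4 - (m : ℝ)) := by positivity
  have key : ε ^ (-(4 / (4 - (m : ℝ)) * (γ / α))) ≤
      ε ^ (-2 - 2 * (m : ℝ) / (4 - (m : ℝ))) * rateFactor α β γ m ε := by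
    rw [hexp]
    by_cases hβγ : γ ≤ β
    · rw [min_eq_right hβγ] at hmin
      have hγα : γ / α ≤ 2 := (div_le_iff₀ hα).2 hmin
      have h4 : ε ^ (-(4 / (4 - (m : ℝ)) * (γ / α))) ≤ ε ^ (-(4 / (4 - (m : ℝ)) * 2)) := by
        refine Real.rpow_le_rpow_of_exponent_ge hε hε1' ?_
        have := mul_le_mul_of_nonneg_left hγα hq.le
        linarith
      refine h4.trans (le_mul_of_one_le_right (by positivity) ?_)
      rw [rateFactor]
      split_ifs with h5 h6
      · exact le_rfl
      · exact one_le_pow₀ hl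
      · exact absurd (le_antisymm (not_lt.1 h5) hβγ) h6
    · rw [not_le] at hβγ
      rw [min_eq_left hβγ.le] at hmin
      rw [rateFactor, if_neg (by linarith), if_neg hβγ.ne, ← Real.rpow_add hε]
      refine Real.rpow_le_rpow_of_exponent_ge hε hε1' ?_
      have hβα : β / α ≤ 2 := (div_le_iff₀ hα).2 hmin
      have := mul_le_mul_of_nonneg_left hβα hq.le
      have e : (β - γ) / α = β / α - γ / α := sub_div _ _ _
      rw [e]
      nlinarith
  calc _ ≤ Real.exp γ / (Real.exp γ - 1) * Real.exp (γ * L) := sum_exp_mul_le hγ L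
    _ ≤ Real.exp γ / (Real.exp γ - 1) * (κ ^ (γ / α) * ε ^ (-(4 / (4 - (m : ℝ)) * (γ / α)))) := by
        gcongr
    _ = Real.exp γ / (Real.exp γ - 1) * κ ^ (γ / α) *
        ε ^ (-(4 / (4 - (m : ℝ)) * (γ / α))) := by ring
    _ ≤ _ := by gcongr

end Rates

theorem tol_eq {w ε : ℝ} (hε : 0 < ε) : tol w ε = Real.sqrt (w / 3) * ε := by
  rw [tol, show w * ε ^ 2 / 3 = w / 3 * ε ^ 2 by ring, Real.sqrt_mul' _ (sq_nonneg _),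
    Real.sqrt_sq hε.le]

theorem tol_pos {w ε : ℝ} (hw : 0 < w) (hε : 0 < ε) : 0 < tol w ε := by
  rw [tol_eq hε]
  positivity

theorem tol_sq {w ε : ℝ} (hw : 0 < w) : tol w ε ^ 2 = w * ε ^ 2 / 3 :=
  Real.sq_sqrt (by positivity)

theorem four_le_numNodes (a b : ℝ) (m : ℕ) (C₁ D εi : ℝ) : 4 ≤ numNodes a b m C₁ D εi :=
  le_max_left _ _

theorem numNodes_le {a b C₁ D w : ℝ} {m : ℕ} (hab : a < b) (hC : 0 < C₁) (hD : 0 ≤ D) (hw : 0 < w)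
    (hm : m ≤ 2) : ∃ K, 1 ≤ K ∧ ∀ ε : ℝ, 0 < ε → ε < Real.exp (-1) →
      (numNodes a b m C₁ D (tol w ε) : ℝ) ≤ K * ε ^ (-(1 / (4 - (m : ℝ)))) := by
  have hm' : (m : ℝ) ≤ 2 := by exact_mod_cast hm
  have hp : 0 < 4 - (m : ℝ) := by linarith
  have hba := sub_pos.2 hab
  have hw' : 0 < Real.sqrt (w / 3) := Real.sqrt_pos.2 (by positivity)
  set B := (C₁ * D / Real.sqrt (w / 3)) ^ (1 / (4 - (m : ℝ))) * (b - a) with hB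
  have hB0 : 0 ≤ B := by positivity
  refine ⟨5 + B, by linarith, fun ε hε hε1 => ?_⟩
  have h1 := one_le_rpow_neg hε (le_one_of_lt_exp_neg_one hε1)
    (show 0 ≤ 1 / (4 - (m : ℝ)) by positivity)
  have e : (C₁ * D / tol w ε) ^ (1 / (4 - (m : ℝ))) * (b - a) =
      B * ε ^ (-(1 / (4 - (m : ℝ)))) := by
    rw [tol_eq hε, ← div_div, Real.div_rpow (by positivity) hε.le, Real.rpow_neg hε.le]
    ring
  rw [numNodes, e]
  have h2 := (Nat.ceil_lt_add_one (show 0 ≤ B * ε ^ (-(1 / (4 - (m : ℝ)))) by positivity)).le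
  push_cast
  refine max_le (by nlinarith) (h2.trans (by nlinarith))

theorem cConst_nonneg (n : ℕ) : 0 ≤ cConst n := by
  have : 0 ≤ Real.log ((n : ℝ) + 1) := Real.log_nonneg (by linarith [n.cast_nonneg (α := ℝ)])
  have hπ := Real.pi_pos
  rw [cConst]
  positivity

theorem cConst_pos {n : ℕ} (hn : 4 ≤ n) : 0 < cConst n := by
  have hn' : (4 : ℝ) ≤ n := by exact_mod_cast hn
  have : 0 < Real.log ((n : ℝ) + 1) := Real.log_pos (by linarith)
  have hπ := Real.pi_pos
  rw [cConst]
  positivity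

/-- The series in `cConst` converges. -/
theorem cConst_le : ∃ K, 0 < K ∧ ∀ n : ℕ, cConst n ≤ K * (Real.log ((n : ℝ) + 1) + 1) := by
  have hs : Summable fun k : ℕ => ((k : ℝ) ^ 2)⁻¹ * 2 :=
    (Real.summable_nat_pow_inv.2 one_lt_two).mul_right 2
  set S := ∑' k : ℕ, ((k : ℝ) ^ 2)⁻¹ * 2
  have hS : 0 ≤ S := tsum_nonneg fun k => by positivity
  have hπ := Real.pi_pos
  refine ⟨2 * Real.pi * (1 + Real.sqrt (8 / Real.pi) * S), by positivity, fun n => ?_⟩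
  have hl : 0 ≤ Real.log ((n : ℝ) + 1) := Real.log_nonneg (by linarith [n.cast_nonneg (α := ℝ)])
  have hsum : ∑ k ∈ Finset.Icc 2 (n + 1),
      ((k : ℝ) ^ 2)⁻¹ * (Real.sqrt (Real.log (k : ℝ)))⁻¹ ≤ S := by
    refine (Finset.sum_le_sum fun k hk => ?_).trans (hs.sum_le_tsum _ fun k _ => by positivity)
    have hk2 : (2 : ℝ) ≤ k := by exact_mod_cast (Finset.mem_Icc.1 hk).1
    refine mul_le_mul_of_nonneg_left ?_ (by positivity)
    have h1 : 1 / 2 ≤ Real.sqrt (Real.log k) := by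
      refine Real.le_sqrt_of_sq_le ?_
      have := Real.log_le_log (by norm_num) hk2
      linarith [Real.log_two_gt_d9]
    rw [inv_le_comm₀ (by linarith) (by norm_num)]
    linarith
  rw [cConst, mul_assoc (2 * Real.pi) (1 + _)]
  refine mul_le_mul_of_nonneg_left ?_ (by positivity)
  have h2 := mul_le_mul_of_nonneg_left hsum (Real.sqrt_nonneg (8 / Real.pi))
  have h3 : 0 ≤ Real.sqrt (8 / Real.pi) * S := by positivity
  nlinarith

theorem cConst_le_log_inv {C : ℝ} (hC : 1 ≤ C) {m : ℕ} (hm : m ≤ 2) :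
    ∃ K, 0 < K ∧ ∀ ε : ℝ, 0 < ε → ε < Real.exp (-1) → ∀ n : ℕ, 4 ≤ n →
      (n : ℝ) ≤ C * ε ^ (-(1 / (4 - (m : ℝ)))) → cConst n ≤ K * Real.log ε⁻¹ := by
  have hm' : (m : ℝ) ≤ 2 := by exact_mod_cast hm
  obtain ⟨K, hK, H⟩ := cConst_le
  have hlC : 0 ≤ Real.log (2 * C) := Real.log_nonneg (by linarith)
  refine ⟨K * (Real.log (2 * C) + 2), by positivity, fun ε hε hε1 n hn h => (H n).trans ?_⟩
  have hn' : (4 : ℝ) ≤ n := by exact_mod_cast hn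
  have hl := one_le_log_inv hε hε1
  rw [mul_assoc]
  refine mul_le_mul_of_nonneg_left ?_ hK.le
  have h1 : Real.log ((n : ℝ) + 1) ≤ Real.log (2 * C * ε ^ (-(1 / (4 - (m : ℝ))))) :=
    Real.log_le_log (by linarith) (by linarith)
  rw [Real.log_mul (by positivity) (by positivity), Real.log_rpow hε] at h1
  have hq : 1 / (4 - (m : ℝ)) ≤ 1 := by
    rw [div_le_one (by linarith)]
    linarith
  have h2 : -(1 / (4 - (m : ℝ))) * Real.log ε ≤ 1 * Real.log ε⁻¹ := by
    rw [neg_mul, ← mul_neg, ← Real.log_inv]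
    gcongr
  nlinarith

/-- The set over which `numLevels` takes the minimum is not empty. -/
theorem exists_bias_le {bias : ℕ → ℝ} {cα α δ : ℝ} (hα : 0 < α) (hδ : 0 < δ)
    (h : ∀ l : ℕ, bias l ≤ cα * Real.exp (-α * l)) : ∃ K, bias K ≤ δ := by
  have ht : Filter.Tendsto (fun l : ℕ => cα * Real.exp (-α * l)) Filter.atTop (nhds (cα * 0)) := by
    refine Filter.Tendsto.const_mul _ (Real.tendsto_exp_atBot.comp ?_)
    exact tendsto_natCast_atTop_atTop.const_mul_atTop_of_neg (by linarith)
  rw [mul_zero] at ht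
  obtain ⟨K, hK⟩ := (ht.eventually (gt_mem_nhds hδ)).exists
  exact ⟨K, (h K).trans hK.le⟩

theorem bias_numLevels_le {bias : ℕ → ℝ} {cα α C₂ C₃ εb : ℝ} {m n : ℕ} (hα : 0 < α)
    (hC₂ : 0 < C₂) (hC₃ : 0 < C₃) (hn : 4 ≤ n) (hε : 0 < εb)
    (h : ∀ l : ℕ, bias l ≤ cα * Real.exp (-α * l)) :
    bias (numLevels bias m C₂ C₃ εb n) ≤ εb / (C₂ * C₃ * ((n : ℝ) - 1) ^ m) := by
  have := natCast_sub_one_pos hn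
  exact Nat.sInf_mem (s := {K : ℕ | bias K ≤ εb / (C₂ * C₃ * ((n : ℝ) - 1) ^ m)})
    (exists_bias_le hα (by positivity) h)

theorem exp_numLevels_le {C cα α C₂ C₃ w : ℝ} {m : ℕ} (hC : 1 ≤ C)
    (hC₂ : 0 < C₂) (hC₃ : 0 < C₃) (hw : 0 < w) (hm : m ≤ 2) :
    ∃ K, 0 < K ∧ ∀ ε : ℝ, 0 < ε → ε < Real.exp (-1) → ∀ n : ℕ, 4 ≤ n →
      (n : ℝ) ≤ C * ε ^ (-(1 / (4 - (m : ℝ)))) → ∀ bias : ℕ → ℝ,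
      (∀ l : ℕ, bias l ≤ cα * Real.exp (-α * l)) →
      Real.exp (α * numLevels bias m C₂ C₃ (tol w ε) n) ≤ K * ε ^ (-(4 / (4 - (m : ℝ)))) := by
  have hm' : (m : ℝ) ≤ 2 := by exact_mod_cast hm
  have hp : 0 < 4 - (m : ℝ) := by linarith
  have hw' : 0 < Real.sqrt (w / 3) := Real.sqrt_pos.2 (by positivity)
  refine ⟨1 + |cα| * Real.exp α * (C₂ * C₃ * C ^ m) / Real.sqrt (w / 3), by positivity,
    fun ε hε hε1 n hn hnC bias h => ?_⟩
  have hn' := natCast_sub_one_pos hn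
  set L := numLevels bias m C₂ C₃ (tol w ε) n with hL
  have hone := one_le_rpow_neg hε (le_one_of_lt_exp_neg_one hε1)
    (show 0 ≤ 4 / (4 - (m : ℝ)) by positivity)
  have hpos : 0 ≤ |cα| * Real.exp α * (C₂ * C₃ * C ^ m) / Real.sqrt (w / 3) := by positivity
  rcases Nat.eq_zero_or_pos L with h0 | h0
  · rw [h0]
    simp only [Nat.cast_zero, mul_zero, Real.exp_zero]
    nlinarith
  · -- the level before the last one violates the bias condition
    have hlt : tol w ε / (C₂ * C₃ * ((n : ℝ) - 1) ^ m) < bias (L - 1) := by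
      by_contra hcon
      have := Nat.sInf_le (s := {K : ℕ | bias K ≤ tol w ε / (C₂ * C₃ * ((n : ℝ) - 1) ^ m)})
        (not_lt.1 hcon)
      have hL' : L ≤ L - 1 := this
      omega
    have h1 := hlt.trans_le (h (L - 1))
    have e1 : Real.exp (-α * (L - 1 : ℕ)) = Real.exp α / Real.exp (α * L) := by
      rw [← Real.exp_sub, Nat.cast_sub h0]
      congr 1
      push_cast
      ring
    rw [e1, ← mul_div_assoc, lt_div_iff₀ (Real.exp_pos _), div_mul_eq_mul_div,
      div_lt_iff₀ (by positivity)] at h1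
    have h2 : ((n : ℝ) - 1) ^ m ≤ C ^ m * ε ^ (-(m / (4 - (m : ℝ)))) := by
      calc ((n : ℝ) - 1) ^ m ≤ (C * ε ^ (-(1 / (4 - (m : ℝ))))) ^ m :=
            pow_le_pow_left₀ hn'.le (by linarith) m
        _ = _ := by
            rw [mul_pow, ← Real.rpow_mul_natCast hε.le]
            congr 2
            ring
    have h3 : tol w ε * Real.exp (α * L) ≤
        |cα| * Real.exp α * (C₂ * C₃ * (C ^ m * ε ^ (-(m / (4 - (m : ℝ)))))) := by
      refine h1.le.trans ?_
      have := le_abs_self cα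
      gcongr
    have e2 : ε ^ (-(4 / (4 - (m : ℝ)))) = ε ^ (-(m / (4 - (m : ℝ)))) / ε := by
      rw [← Real.rpow_sub_one hε.ne']
      congr 1
      field_simp
      ring
    have h4 : Real.exp (α * L) ≤ |cα| * Real.exp α * (C₂ * C₃ * C ^ m) / Real.sqrt (w / 3) *
        ε ^ (-(4 / (4 - (m : ℝ)))) := by
      rw [tol_eq hε] at h3
      rw [e2, div_mul_div_comm, le_div_iff₀ (by positivity)]
      linarith
    refine h4.trans ?_
    rw [add_mul, one_mul]
    linarith

/-- The common factor of the sample sizes. -/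
noncomputable def sampleFactor (m : ℕ) (C₂ C₃ εs : ℝ) (n : ℕ) : ℝ :=
  C₂ ^ 2 * C₃ ^ 2 * cConst n * ((n : ℝ) - 1) ^ (2 * m) / εs ^ 2

theorem sampleFactor_pos {m n : ℕ} {C₂ C₃ εs : ℝ} (hn : 4 ≤ n) (hC₂ : 0 < C₂) (hC₃ : 0 < C₃)
    (hε : 0 < εs) : 0 < sampleFactor m C₂ C₃ εs n := by
  have h1 := natCast_sub_one_pos hn
  have h2 := cConst_pos hn
  rw [sampleFactor]
  positivity

theorem sampleFactor_le {C C₂ C₃ w : ℝ} {m : ℕ} (hC : 1 ≤ C)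
    (hC₂ : 0 < C₂) (hC₃ : 0 < C₃) (hw : 0 < w) (hm : m ≤ 2) :
    ∃ K, 0 < K ∧ ∀ ε : ℝ, 0 < ε → ε < Real.exp (-1) → ∀ n : ℕ, 4 ≤ n →
      (n : ℝ) ≤ C * ε ^ (-(1 / (4 - (m : ℝ)))) →
      sampleFactor m C₂ C₃ (tol w ε) n ≤
        K * (Real.log ε⁻¹ * ε ^ (-2 - 2 * (m : ℝ) / (4 - (m : ℝ)))) := by
  obtain ⟨K, hK, H⟩ := cConst_le_log_inv hC hm
  refine ⟨C₂ ^ 2 * C₃ ^ 2 * K * C ^ (2 * m) / (w / 3), by positivity,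
    fun ε hε hε1 n hn hnC => ?_⟩
  have hn' := natCast_sub_one_pos hn
  have hl := one_le_log_inv hε hε1
  have h1 := H ε hε hε1 n hn hnC
  have h2 : ((n : ℝ) - 1) ^ (2 * m) ≤ C ^ (2 * m) * ε ^ (-(2 * m / (4 - (m : ℝ)))) := by
    calc ((n : ℝ) - 1) ^ (2 * m) ≤ (C * ε ^ (-(1 / (4 - (m : ℝ))))) ^ (2 * m) :=
          pow_le_pow_left₀ hn'.le (by linarith) _
      _ = _ := by
          rw [mul_pow, ← Real.rpow_mul_natCast hε.le]
          congr 2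
          push_cast
          ring
  have e : ε ^ (-2 - 2 * (m : ℝ) / (4 - (m : ℝ))) = ε ^ (-(2 * m / (4 - (m : ℝ)))) / ε ^ 2 := by
    rw [← Real.rpow_sub_natCast hε.ne']
    congr 1
    push_cast
    ring
  have hc := cConst_nonneg n
  calc sampleFactor m C₂ C₃ (tol w ε) n
      ≤ C₂ ^ 2 * C₃ ^ 2 * (K * Real.log ε⁻¹) * (C ^ (2 * m) *
        ε ^ (-(2 * m / (4 - (m : ℝ))))) / tol w ε ^ 2 := by
        rw [sampleFactor]
        gcongr
    _ = _ := by
        rw [tol_sq hw, e]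
        field_simp

theorem mlmcCost_numSamples_le {V cost : ℕ → ℝ} {m n L : ℕ} {C₂ C₃ εs : ℝ} (hn : 4 ≤ n)
    (hC₂ : 0 < C₂) (hC₃ : 0 < C₃) (hε : 0 < εs) (hcost : ∀ l, 0 < cost l) :
    mlmcCost cost L (numSamples V cost m C₂ C₃ εs n L) ≤
      sampleFactor m C₂ C₃ εs n * (∑ l ∈ Finset.range (L + 1), Real.sqrt (V l * cost l)) ^ 2 +
        ∑ l ∈ Finset.range (L + 1), cost l := by
  set A := sampleFactor m C₂ C₃ εs n with hA
  set T := ∑ l ∈ Finset.range (L + 1), Real.sqrt (V l * cost l) with hT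
  have hA0 : 0 < A := sampleFactor_pos hn hC₂ hC₃ hε
  have hT0 : 0 ≤ T := Finset.sum_nonneg fun _ _ => Real.sqrt_nonneg _
  have : A * T ^ 2 + ∑ l ∈ Finset.range (L + 1), cost l =
      ∑ l ∈ Finset.range (L + 1), (A * T * Real.sqrt (V l * cost l) + cost l) := by
    rw [Finset.sum_add_distrib, ← Finset.mul_sum, ← hT]
    ring
  rw [this, mlmcCost]
  refine Finset.sum_le_sum fun l _ => ?_
  have hN : (numSamples V cost m C₂ C₃ εs n L l : ℝ) ≤ A * Real.sqrt (V l / cost l) * T + 1 :=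
    (Nat.ceil_lt_add_one (by positivity)).le
  have hc := hcost l
  have e : Real.sqrt (V l / cost l) * cost l = Real.sqrt (V l * cost l) := by
    rw [show V l * cost l = V l / cost l * cost l ^ 2 by field_simp,
      Real.sqrt_mul' _ (sq_nonneg _), Real.sqrt_sq hc.le]
  calc (numSamples V cost m C₂ C₃ εs n L l : ℝ) * cost l
      ≤ (A * Real.sqrt (V l / cost l) * T + 1) * cost l := by gcongr
    _ = A * T * (Real.sqrt (V l / cost l) * cost l) + cost l := by ring
    _ = _ := by rw [e]

/-- The sample sizes balance the variances: their weighted sum meets the tolerance. -/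
theorem sampleFactor_mul_sum_div_le {V cost : ℕ → ℝ} {m n L : ℕ} {C₂ C₃ εs : ℝ} (hn : 4 ≤ n)
    (hC₂ : 0 < C₂) (hC₃ : 0 < C₃) (hε : 0 < εs) (hcost : ∀ l, 0 < cost l) (hV : ∀ l, 0 ≤ V l) :
    sampleFactor m C₂ C₃ εs n *
      ∑ l ∈ Finset.range (L + 1), V l / numSamples V cost m C₂ C₃ εs n L l ≤ 1 := by
  set A := sampleFactor m C₂ C₃ εs n with hA
  set T := ∑ l ∈ Finset.range (L + 1), Real.sqrt (V l * cost l) with hT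
  have hA0 : 0 < A := sampleFactor_pos hn hC₂ hC₃ hε
  have hT0 : 0 ≤ T := Finset.sum_nonneg fun _ _ => Real.sqrt_nonneg _
  have hterm : ∀ l ∈ Finset.range (L + 1), V l / numSamples V cost m C₂ C₃ εs n L l ≤
      Real.sqrt (V l * cost l) / (A * T) := by
    intro l hl
    have hc := hcost l
    rcases (hV l).eq_or_lt with h0 | h0
    · rw [← h0]
      simp
    have hs : 0 < Real.sqrt (V l / cost l) := Real.sqrt_pos.2 (by positivity)
    have hT1 : 0 < T := by
      have := Finset.single_le_sum (f := fun l => Real.sqrt (V l * cost l))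
        (fun _ _ => Real.sqrt_nonneg _) hl
      exact (Real.sqrt_pos.2 (by positivity)).trans_le this
    have hN : A * Real.sqrt (V l / cost l) * T ≤ (numSamples V cost m C₂ C₃ εs n L l : ℝ) :=
      Nat.le_ceil _
    have e : V l = Real.sqrt (V l / cost l) * Real.sqrt (V l * cost l) := by
      rw [← Real.sqrt_mul (by positivity),
        show V l / cost l * (V l * cost l) = V l ^ 2 by field_simp,
        Real.sqrt_sq h0.le]
    calc V l / numSamples V cost m C₂ C₃ εs n L l ≤ V l / (A * Real.sqrt (V l / cost l) * T) := by
          gcongr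
      _ = Real.sqrt (V l / cost l) * Real.sqrt (V l * cost l) /
          (A * Real.sqrt (V l / cost l) * T) := by rw [← e]
      _ = _ := by field_simp
  calc _ ≤ A * ∑ l ∈ Finset.range (L + 1), Real.sqrt (V l * cost l) / (A * T) :=
        mul_le_mul_of_nonneg_left (Finset.sum_le_sum hterm) hA0.le
    _ = A * T / (A * T) := by rw [← Finset.sum_div, ← hT, mul_div_assoc]
    _ ≤ 1 := div_self_le_one _

theorem numSamples_ne_zero {V cost : ℕ → ℝ} {m n L l : ℕ} {C₂ C₃ εs : ℝ} (hn : 4 ≤ n)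
    (hC₂ : 0 < C₂) (hC₃ : 0 < C₃) (hε : 0 < εs) (hcost : ∀ l, 0 < cost l) (hl : l ≤ L)
    (hV : 0 < V l) : numSamples V cost m C₂ C₃ εs n L l ≠ 0 := by
  have hA0 : 0 < sampleFactor m C₂ C₃ εs n := sampleFactor_pos hn hC₂ hC₃ hε
  have hc := hcost l
  have hT1 : 0 < ∑ l ∈ Finset.range (L + 1), Real.sqrt (V l * cost l) := by
    have := Finset.single_le_sum (f := fun l => Real.sqrt (V l * cost l))
      (fun _ _ => Real.sqrt_nonneg _) (Finset.mem_range.2 (Nat.lt_succ_of_le hl))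
    exact (Real.sqrt_pos.2 (by positivity)).trans_le this
  have hs : 0 < Real.sqrt (V l / cost l) := Real.sqrt_pos.2 (by positivity)
  refine (Nat.ceil_pos.2 ?_).ne'
  rw [sampleFactor] at hA0
  positivity

/-- The complexity bound. -/
theorem exists_mlmcCost_le {a b C₁ C₂ C₃ D cα cβ cγ α β γ wi wb ws : ℝ} {m : ℕ}
    {cost : ℕ → ℝ} {bias V : ℕ → ℕ → ℝ} (hab : a < b) (hC₁ : 0 < C₁) (hC₂ : 0 < C₂)
    (hC₃ : 0 < C₃) (hD : 0 ≤ D) (hcost : ∀ l, 0 < cost l) (hα : 0 < α) (hγ : 0 < γ)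
    (hmin : min β γ ≤ 2 * α) (hbias : ∀ n l : ℕ, 4 ≤ n → bias n l ≤ cα * Real.exp (-α * l))
    (hV : ∀ n l : ℕ, 4 ≤ n → V n l ≤ cβ * Real.exp (-β * l))
    (hcγ : ∀ l : ℕ, cost l ≤ cγ * Real.exp (γ * l))
    (hwi : 0 < wi) (hwb : 0 < wb) (hws : 0 < ws) (hm : m ≤ 2) :
    ∃ K : ℝ, 0 < K ∧ ∀ ε : ℝ, 0 < ε → ε < Real.exp (-1) → ∀ n L : ℕ,
      n = numNodes a b m C₁ D (tol wi ε) → L = numLevels (bias n) m C₂ C₃ (tol wb ε) n →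
      mlmcCost cost L (numSamples (V n) cost m C₂ C₃ (tol ws ε) n L) ≤
        K * (Real.log ε⁻¹ * ε ^ (-2 - 2 * (m : ℝ) / (4 - (m : ℝ))) * rateFactor α β γ m ε) := by
  obtain ⟨K₁, hK₁, H₁⟩ := numNodes_le hab hC₁ hD hwi hm
  obtain ⟨K₂, hK₂, H₂⟩ := exp_numLevels_le (cα := cα) (α := α) hK₁ hC₂ hC₃ hwb hm
  obtain ⟨K₃, hK₃, H₃⟩ := sampleFactor_le hK₁ hC₂ hC₃ hws hm
  obtain ⟨K₄, hK₄, H₄⟩ := sq_sum_exp_le_rateFactor (β := β) (γ := γ) hα hm hK₂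
  obtain ⟨K₅, hK₅, H₅⟩ := sum_exp_le_rateFactor hα hγ hmin hm hK₂
  have hcγ0 : 0 < cγ := by
    have := (hcost 0).trans_le (hcγ 0)
    simpa using this
  refine ⟨K₃ * (|cβ| * cγ * K₄) + cγ * K₅, by positivity, fun ε hε hε1 n L hn hL => ?_⟩
  have hn4 : 4 ≤ n := hn ▸ four_le_numNodes _ _ _ _ _ _
  have hnK : (n : ℝ) ≤ K₁ * ε ^ (-(1 / (4 - (m : ℝ)))) := hn ▸ H₁ ε hε hε1
  have hexpL := H₂ ε hε hε1 n hn4 hnK (bias n) (fun l => hbias n l hn4)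
  rw [← hL] at hexpL
  have hl := one_le_log_inv hε hε1
  have hr := rateFactor_pos (α := α) (β := β) (γ := γ) (m := m) hε hε1
  have hT : (∑ l ∈ Finset.range (L + 1), Real.sqrt (V n l * cost l)) ^ 2 ≤
      |cβ| * cγ * K₄ * rateFactor α β γ m ε := by
    have h1 : ∑ l ∈ Finset.range (L + 1), Real.sqrt (V n l * cost l) ≤
        Real.sqrt (|cβ| * cγ) * ∑ l ∈ Finset.range (L + 1), Real.exp ((γ - β) / 2 * l) := by
      rw [Finset.mul_sum]
      refine Finset.sum_le_sum fun l _ => ?_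
      have h2 : V n l * cost l ≤ |cβ| * cγ * Real.exp ((γ - β) / 2 * l) ^ 2 := by
        calc V n l * cost l ≤ (|cβ| * Real.exp (-β * l)) * (cγ * Real.exp (γ * l)) := by
              refine mul_le_mul ((hV n l hn4).trans ?_) (hcγ l) (hcost l).le (by positivity)
              have := le_abs_self cβ
              gcongr
          _ = |cβ| * cγ * (Real.exp (-β * l) * Real.exp (γ * l)) := by ring
          _ = _ := by
              rw [← Real.exp_add, ← Real.exp_nat_mul]
              congr 2
              push_cast
              ring
      refine (Real.sqrt_le_sqrt h2).trans_eq ?_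
      rw [Real.sqrt_mul' _ (sq_nonneg _), Real.sqrt_sq (Real.exp_pos _).le]
    calc _ ≤ (Real.sqrt (|cβ| * cγ) *
          ∑ l ∈ Finset.range (L + 1), Real.exp ((γ - β) / 2 * l)) ^ 2 :=
          pow_le_pow_left₀ (Finset.sum_nonneg fun _ _ => Real.sqrt_nonneg _) h1 2
      _ = |cβ| * cγ * (∑ l ∈ Finset.range (L + 1), Real.exp ((γ - β) / 2 * l)) ^ 2 := by
          rw [mul_pow, Real.sq_sqrt (by positivity)]
      _ ≤ |cβ| * cγ * (K₄ * rateFactor α β γ m ε) := by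
          have := H₄ ε hε hε1 L hexpL
          gcongr
      _ = _ := by ring
  have hS : ∑ l ∈ Finset.range (L + 1), cost l ≤
      cγ * (K₅ * (ε ^ (-2 - 2 * (m : ℝ) / (4 - (m : ℝ))) * rateFactor α β γ m ε)) := by
    calc _ ≤ ∑ l ∈ Finset.range (L + 1), cγ * Real.exp (γ * l) :=
          Finset.sum_le_sum fun l _ => hcγ l
      _ = cγ * ∑ l ∈ Finset.range (L + 1), Real.exp (γ * l) := by rw [Finset.mul_sum]
      _ ≤ _ := by
          have := H₅ ε hε hε1 L hexpL
          gcongr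
  have hA := H₃ ε hε hε1 n hn4 hnK
  have hεp : 0 < ε ^ (-2 - 2 * (m : ℝ) / (4 - (m : ℝ))) := by positivity
  set X := ε ^ (-2 - 2 * (m : ℝ) / (4 - (m : ℝ)))
  set ρ := rateFactor α β γ m ε
  calc _ ≤ _ := mlmcCost_numSamples_le hn4 hC₂ hC₃ (tol_pos hws hε) hcost
    _ ≤ K₃ * (Real.log ε⁻¹ * X) * (|cβ| * cγ * K₄ * ρ) + cγ * (K₅ * (X * ρ)) := by
        refine add_le_add (mul_le_mul hA hT (sq_nonneg _) (by positivity)) hS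
    _ ≤ K₃ * (Real.log ε⁻¹ * X) * (|cβ| * cγ * K₄ * ρ) + cγ * (K₅ * (X * ρ)) * Real.log ε⁻¹ := by
        refine add_le_add le_rfl (le_mul_of_one_le_right (by positivity) hl)
    _ = _ := by ring

/-! ### Mean and second moment of the multilevel estimator at the nodes -/

/-- The increment on level `l` at the nodes as a function of the sample `(Q_l, Q_{l-1})`; the second
component is not used on level `0`. -/
noncomputable def sampleIncrement (τ a b : ℝ) (n : ℕ) : ℕ → ℝ × ℝ → Fin n → ℝ
  | 0, y, j => phi τ (gridNode a b n j) y.1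
  | _ + 1, y, j => phi τ (gridNode a b n j) y.1 - phi τ (gridNode a b n j) y.2

theorem measurable_phi (τ θ : ℝ) : Measurable (phi τ θ) := by
  unfold phi
  fun_prop

theorem measurable_sampleIncrement (τ a b : ℝ) (n l : ℕ) :
    Measurable (sampleIncrement τ a b n l) := by
  refine measurable_pi_lambda _ fun j => ?_
  cases l with
  | zero => exact (measurable_phi τ _).comp measurable_fst
  | succ l =>
    exact ((measurable_phi τ _).comp measurable_fst).sub ((measurable_phi τ _).comp measurable_snd)

theorem mlmcPoint_eq {Ω : Type*} (τ a b : ℝ) (n : ℕ) (Y : ℕ → ℕ → Ω → ℝ × ℝ) (L : ℕ)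
    (N : ℕ → ℕ) (j : Fin n) (ω : Ω) :
    mlmcPoint τ Y L N (gridNode a b n j) ω =
      ∑ l ∈ Finset.range (L + 1), ∑ i ∈ Finset.range (N l),
        1 / (N l : ℝ) * sampleIncrement τ a b n l (Y l i ω) j := by
  have e : Finset.Icc 1 L = (Finset.range L).image (· + 1) := by
    ext k
    simp only [Finset.mem_Icc, Finset.mem_image, Finset.mem_range]
    exact ⟨fun h => ⟨k - 1, by omega, by omega⟩, by rintro ⟨i, hi, rfl⟩; omega⟩
  rw [mlmcPoint, Finset.sum_range_succ', add_comm, e,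
    Finset.sum_image fun _ _ _ _ h => Nat.succ_injective h]
  simp only [Finset.mul_sum]
  rfl

section Estimator

variable {Ω Ω' : Type*} [MeasurableSpace Ω] [MeasurableSpace Ω'] {P : Measure Ω}
  {P' : Measure Ω'} {τ a b : ℝ}
  {Q : ℕ → Ω → ℝ} {Y : ℕ → ℕ → Ω' → ℝ × ℝ} {n : ℕ}

theorem identDistrib_sampleIncrement
    (hY₀ : ∀ i, IdentDistrib (fun ω => (Y 0 i ω).1) (Q 0) P' P)
    (hY : ∀ l i, IdentDistrib (Y (l + 1) i) (fun ω => (Q (l + 1) ω, Q l ω)) P' P) (l i : ℕ) :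
    IdentDistrib (fun ω => sampleIncrement τ a b n l (Y l i ω))
      (fun ω (j : Fin n) => increment τ Q (gridNode a b n j) l ω) P' P := by
  cases l with
  | zero =>
    exact (hY₀ i).comp (u := fun q (j : Fin n) => phi τ (gridNode a b n j) q)
      (measurable_pi_lambda _ fun j => measurable_phi τ _)
  | succ l => exact (hY l i).comp (measurable_sampleIncrement τ a b n (l + 1))

theorem memLp_increment (hab : a < b) (hn : 4 ≤ n)
    (hQ : ∀ l, ∀ θ ∈ Icc a b, MemLp (fun ω => phi τ θ (Q l ω)) 2 P) (l : ℕ) :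
    MemLp (fun ω (j : Fin n) => increment τ Q (gridNode a b n j) l ω) 2 P := by
  refine MemLp.of_eval fun j => ?_
  have hθ := gridNode_mem hab hn j.2
  cases l with
  | zero => exact hQ 0 _ hθ
  | succ l => exact (hQ (l + 1) _ hθ).sub (hQ l _ hθ)

/-- The expected increments add up to the expectation on the last level. -/
theorem sum_integral_increment [IsProbabilityMeasure P] {θ : ℝ}
    (hQ : ∀ l, MemLp (fun ω => phi τ θ (Q l ω)) 2 P) (L : ℕ) :
    ∑ l ∈ Finset.range (L + 1), ∫ ω, increment τ Q θ l ω ∂P = paramExp P τ (Q L) θ := by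
  have hi : ∀ l, Integrable (fun ω => phi τ θ (Q l ω)) P := fun l => (hQ l).integrable one_le_two
  induction L with
  | zero => simp [increment, paramExp]
  | succ L ih =>
    rw [Finset.sum_range_succ, ih]
    simp only [increment, paramExp]
    rw [integral_sub (hi (L + 1)) (hi L)]
    ring

/-- The fluctuation of the pointwise estimators, with the maximum over the nodes inside the
expectation. A level without samples is harmless if its increment vanishes. -/
theorem integral_norm_sq_mlmcPoint_sub_le [IsProbabilityMeasure P] [IsProbabilityMeasure P']
    (hab : a < b) (hn : 4 ≤ n)
    (hQ : ∀ l, ∀ θ ∈ Icc a b, MemLp (fun ω => phi τ θ (Q l ω)) 2 P)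
    (hind : iIndepFun (fun (p : ℕ × ℕ) => Y p.1 p.2) P')
    (hY₀ : ∀ i, IdentDistrib (fun ω => (Y 0 i ω).1) (Q 0) P' P)
    (hY : ∀ l i, IdentDistrib (Y (l + 1) i) (fun ω => (Q (l + 1) ω, Q l ω)) P' P)
    {L : ℕ} {N : ℕ → ℕ} (hN : ∀ l ≤ L, 0 < levelVar P τ a b Q n l → N l ≠ 0) :
    MemLp (fun ω (j : Fin n) => mlmcPoint τ Y L N (gridNode a b n j) ω -
        paramExp P τ (Q L) (gridNode a b n j)) 2 P' ∧
      ∫ ω, ‖fun j : Fin n => mlmcPoint τ Y L N (gridNode a b n j) ω -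
        paramExp P τ (Q L) (gridNode a b n j)‖ ^ 2 ∂P' ≤
      cConst n * ∑ l ∈ Finset.range (L + 1), levelVar P τ a b Q n l / N l := by
  set X : (Σ _ : ℕ, ℕ) → Ω' → Fin n → ℝ := fun p ω =>
    (1 / (N p.1 : ℝ)) • sampleIncrement τ a b n p.1 (Y p.1 p.2 ω) with hX
  have hid := fun l i => identDistrib_sampleIncrement (τ := τ) (a := a) (b := b) (n := n) hY₀ hY l i
  have hinc := fun l => memLp_increment (τ := τ) (Q := Q) (P := P) hab hn hQ l
  have hmem : ∀ l i, MemLp (fun ω => sampleIncrement τ a b n l (Y l i ω)) 2 P' := fun l i =>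
    (hid l i).memLp_iff.2 (hinc l)
  have hXmem : ∀ p, MemLp (X p) 2 P' := fun p =>
    (hmem p.1 p.2).const_smul (1 / (N p.1 : ℝ))
  have hXind : iIndepFun X P' := by
    have hinj : Function.Injective (fun p : Σ _ : ℕ, ℕ => ((p.1, p.2) : ℕ × ℕ)) := by
      rintro ⟨i, j⟩ ⟨k, l⟩ h
      simp only [Prod.mk.injEq] at h
      rw [h.1, h.2]
    exact (hind.precomp hinj).comp
      (fun p y => (1 / (N p.1 : ℝ)) • sampleIncrement τ a b n p.1 y)
      (fun p => (measurable_sampleIncrement τ a b n p.1).const_smul (1 / (N p.1 : ℝ)))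
  set S : Finset (Σ _ : ℕ, ℕ) := (Finset.range (L + 1)).sigma fun l => Finset.range (N l) with hS
  have hmean : ∀ l i, ∫ ω, sampleIncrement τ a b n l (Y l i ω) ∂P' =
      ∫ ω, (fun j : Fin n => increment τ Q (gridNode a b n j) l ω) ∂P := fun l i =>
    (hid l i).integral_eq
  have hlevel : ∀ l ≤ L, ∑ _i ∈ Finset.range (N l), (1 / (N l : ℝ)) •
      ∫ ω, (fun j : Fin n => increment τ Q (gridNode a b n j) l ω) ∂P =
      ∫ ω, (fun j : Fin n => increment τ Q (gridNode a b n j) l ω) ∂P := by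
    intro l hl
    -- for `N l = 0` the average is zero, and so is the increment, almost surely
    by_cases h0 : N l = 0
    · have hV0 : levelVar P τ a b Q n l = 0 := by
        refine le_antisymm (not_lt.1 fun h => hN l hl h h0) ?_
        exact integral_nonneg fun ω => sq_nonneg _
      have hae := (integral_eq_zero_iff_of_nonneg (fun ω => sq_nonneg _)
        ((hinc l).integrable_norm_pow (by simp))).1 hV0
      have : ∫ ω, (fun j : Fin n => increment τ Q (gridNode a b n j) l ω) ∂P = 0 := by
        refine integral_eq_zero_of_ae ?_
        filter_upwards [hae] with ω hω
        simpa using hω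
      rw [this]
      simp
    · rw [Finset.sum_const, Finset.card_range, ← Nat.cast_smul_eq_nsmul ℝ, smul_smul,
        mul_one_div_cancel (by exact_mod_cast h0), one_smul]
  have hsum : ∀ ω, (fun j : Fin n => mlmcPoint τ Y L N (gridNode a b n j) ω -
      paramExp P τ (Q L) (gridNode a b n j)) = ∑ p ∈ S, (X p ω - ∫ ω', X p ω' ∂P') := by
    intro ω
    have h1 : ∑ p ∈ S, ∫ ω', X p ω' ∂P' =
        fun j : Fin n => paramExp P τ (Q L) (gridNode a b n j) := by
      rw [hS, Finset.sum_sigma]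
      simp only [hX, integral_smul, hmean]
      rw [Finset.sum_congr rfl fun l hl => hlevel l (Nat.lt_succ_iff.1 (Finset.mem_range.1 hl))]
      funext j
      rw [Finset.sum_apply, ← sum_integral_increment (fun l => hQ l _ (gridNode_mem hab hn j.2)) L]
      refine Finset.sum_congr rfl fun l _ => ?_
      exact eval_integral (fun i => ((hinc l).eval i).integrable one_le_two) j
    have h2 : ∑ p ∈ S, X p ω = fun j : Fin n => mlmcPoint τ Y L N (gridNode a b n j) ω := by
      funext j
      rw [mlmcPoint_eq, hS, Finset.sum_sigma, Finset.sum_apply]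
      refine Finset.sum_congr rfl fun l _ => ?_
      rw [Finset.sum_apply]
      rfl
    rw [Finset.sum_sub_distrib, h1, h2]
    rfl
  have hvar : ∑ p ∈ S, ∫ ω, ‖X p ω‖ ^ 2 ∂P' =
      ∑ l ∈ Finset.range (L + 1), levelVar P τ a b Q n l / N l := by
    rw [hS, Finset.sum_sigma]
    refine Finset.sum_congr rfl fun l _ => ?_
    have h1 : ∀ i, ∫ ω, ‖X ⟨l, i⟩ ω‖ ^ 2 ∂P' = (1 / (N l : ℝ)) ^ 2 * levelVar P τ a b Q n l := by
      intro i
      have := ((hid l i).comp (u := fun x : Fin n → ℝ => ‖x‖ ^ 2) (by fun_prop)).integral_eq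
      simp only [Function.comp_def] at this
      rw [levelVar, ← this, ← integral_const_mul]
      simp only [hX, norm_smul, mul_pow, Real.norm_eq_abs, sq_abs]
    simp only [h1]
    rw [Finset.sum_const, Finset.card_range, nsmul_eq_mul]
    by_cases h0 : N l = 0
    · simp [h0]
    · have : (N l : ℝ) ≠ 0 := by exact_mod_cast h0
      field_simp
  refine ⟨?_, ?_⟩
  · rw [funext hsum]
    exact memLp_finsetSum S fun p _ => (hXmem p).sub (memLp_const _)
  simp only [hsum]
  rw [← hvar]
  exact integral_norm_sum_centred_sq_le hn hXmem hXind S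

end Estimator

/-! ### The mean squared error -/

/-- The error of the estimator splits into the interpolation error, the bias and the fluctuation,
the last two being splines, to which the inverse inequality and the stability apply. -/
theorem supNorm_sub_derivOn_splineInterp_le {a b C₃ : ℝ} {C₁ C₂ : ℕ → ℝ} (hab : a < b)
    (hC : IsSplineConstants a b C₁ C₂ C₃) {f : ℝ → ℝ} (hf : ContDiffOn ℝ 4 f (Icc a b)) {n : ℕ}
    (hn : 4 ≤ n) {m : ℕ} (hm : m ≤ 2) (y z : Fin n → ℝ) :
    supNorm a b (fun t => derivOn a b m f t - derivOn a b m (splineInterp a b n z) t) ≤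
      ENNReal.ofReal (C₁ m * ((b - a) / n) ^ (4 - m) * (supNorm a b (derivOn a b 4 f)).toReal +
        C₂ m * C₃ * ((n : ℝ) - 1) ^ m * ‖(fun j : Fin n => f (gridNode a b n j)) - y‖ +
        C₂ m * C₃ * ((n : ℝ) - 1) ^ m * ‖z - y‖) := by
  set x : Fin n → ℝ := fun j => f (gridNode a b n j) with hx
  have h1 := hC.pos₁ m hm
  have h2 := hC.pos₂ m hm
  have h3 := hC.pos₃
  have hba := sub_pos.2 hab
  have hn' := natCast_sub_one_pos hn
  have hcoef : 0 ≤ C₂ m * C₃ * ((n : ℝ) - 1) ^ m := by positivity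
  have hcont := continuousOn_derivOn (m := 4) hab hf le_rfl
  have hspline : ∀ v : Fin n → ℝ, supNorm a b (derivOn a b m (splineInterp a b n v)) ≤
      ENNReal.ofReal (C₂ m * C₃ * ((n : ℝ) - 1) ^ m * ‖v‖) := fun v => by
    refine (hC.inverse n hn v m hm).trans ?_
    refine (mul_le_mul_right (hC.stable n hn v) _).trans_eq ?_
    rw [← ENNReal.ofReal_mul (by positivity)]
    congr 1
    ring
  have hsplit : EqOn (fun t => derivOn a b m f t - derivOn a b m (splineInterp a b n z) t)
      (fun t => (derivOn a b m f t - derivOn a b m (splineInterp a b n x) t) +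
        derivOn a b m (splineInterp a b n (x - y)) t +
        -derivOn a b m (splineInterp a b n (z - y)) t) (Icc a b) := fun t ht => by
    simp only [derivOn_splineInterp_sub hab hn _ _ hm ht]
    ring
  rw [supNorm_congr hsplit, ENNReal.ofReal_add (by positivity) (by positivity),
    ENNReal.ofReal_add (by positivity) (by positivity)]
  refine (supNorm_add_le a b _ _).trans (add_le_add ?_ ?_)
  · refine (supNorm_add_le a b _ _).trans (add_le_add ?_ (hspline _))
    refine (hC.interp_error n hn f hf m hm).trans_eq ?_
    rw [ENNReal.ofReal_mul (p := C₁ m * ((b - a) / n) ^ (4 - m)) (by positivity),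
      ENNReal.ofReal_toReal (supNorm_ne_top hcont)]
  · rw [supNorm_neg]
    exact hspline _

/-- The number of nodes makes the interpolation error meet its tolerance. -/
theorem interp_error_numNodes_le {a b C₁ D εi : ℝ} {m : ℕ} (hab : a < b) (hC : 0 < C₁)
    (hD : 0 ≤ D) (hε : 0 < εi) (hm : m ≤ 2) :
    C₁ * ((b - a) / (numNodes a b m C₁ D εi : ℕ)) ^ (4 - m) * D ≤ εi := by
  have hba := sub_pos.2 hab
  set n := numNodes a b m C₁ D εi with hn
  have hn4 : (4 : ℝ) ≤ n := by exact_mod_cast four_le_numNodes a b m C₁ D εi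
  have hp : ((4 - m : ℕ) : ℝ) = 4 - (m : ℝ) := by
    rw [Nat.cast_sub (by omega)]
    norm_num
  have hle : (C₁ * D / εi) ^ (1 / (4 - (m : ℝ))) * (b - a) ≤ n := by
    refine (Nat.le_ceil _).trans ?_
    exact Nat.cast_le.2 (le_max_right _ _)
  have h1 : (C₁ * D / εi) ^ (1 / (4 - (m : ℝ))) * ((b - a) / n) ≤ 1 := by
    rw [← mul_div_assoc, div_le_one (by linarith)]
    exact hle
  have h2 := pow_le_one₀ (n := 4 - m) (by positivity) h1
  rw [mul_pow, ← hp, one_div, Real.rpow_inv_natCast_pow (by positivity) (by omega),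
    div_mul_eq_mul_div, div_le_one hε] at h2
  linarith

theorem proposition1 :
    -- the cubic spline interpolation operator has constants as used in the tuning formulas;
    -- `C₁`, `C₃` are independent of the interval and `C₂ m` scales with its length
    (∃ (C₁ κ : ℕ → ℝ) (C₃ : ℝ), ∀ a b : ℝ, a < b →
      IsSplineConstants a b C₁ (fun m => κ m / (b - a) ^ m) C₃) ∧
    -- the complexity result, for all such constants
    ∀ {Ω Ω' : Type*} [MeasurableSpace Ω] [MeasurableSpace Ω']
      (P : Measure Ω) [IsProbabilityMeasure P] (P' : Measure Ω') [IsProbabilityMeasure P']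
      (τ a b : ℝ) (_ : 0 < τ) (_ : τ < 1) (_ : a < b)
      (C₁ C₂ : ℕ → ℝ) (C₃ : ℝ) (_ : IsSplineConstants a b C₁ C₂ C₃)
      -- the quantity of interest and its approximations
      (Qex : Ω → ℝ) (Q : ℕ → Ω → ℝ) (_ : Measurable Qex) (_ : ∀ l, Measurable (Q l))
      (_ : ∀ θ ∈ Set.Icc a b, Integrable (fun ω => phi τ θ (Qex ω)) P)
      (_ : ∀ l, ∀ θ ∈ Set.Icc a b, MemLp (fun ω => phi τ θ (Q l ω)) 2 P)
      (_ : ContDiffOn ℝ 4 (paramExp P τ Qex) (Set.Icc a b))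
      -- the independent samples `(Q_l^{(i,l)}, Q_{l-1}^{(i,l)})`
      (Y : ℕ → ℕ → Ω' → ℝ × ℝ)
      (_ : iIndepFun (fun (p : ℕ × ℕ) => Y p.1 p.2) P')
      (_ : ∀ i, IdentDistrib (fun ω => (Y 0 i ω).1) (Q 0) P' P)
      (_ : ∀ l i, IdentDistrib (Y (l + 1) i) (fun ω => (Q (l + 1) ω, Q l ω)) P' P)
      -- biases, variances and costs per sample
      (cost : ℕ → ℝ) (_ : ∀ l, 0 < cost l)
      (α β γ : ℝ) (_ : 0 < α) (_ : 0 < β) (_ : 0 < γ) (_ : min β γ ≤ 2 * α)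
      (cα cβ cγ : ℝ)
      (_ : ∀ n l, 4 ≤ n → levelBias P τ a b Qex Q n l ≤ cα * Real.exp (-α * l))
      (_ : ∀ n l, 4 ≤ n → levelVar P τ a b Q n l ≤ cβ * Real.exp (-β * l))
      (_ : ∀ l : ℕ, cost l ≤ cγ * Real.exp (γ * l))
      -- the weights of the three error contributions
      (wi wb ws : ℝ) (_ : 0 < wi) (_ : 0 < wb) (_ : 0 < ws) (_ : wi + wb + ws = 1)
      (m : ℕ) (_ : m ≤ 2),
      ∃ K : ℝ, 0 < K ∧ ∀ ε : ℝ, 0 < ε → ε < Real.exp (-1) →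
        let D : ℝ := (supNorm a b (derivOn a b 4 (paramExp P τ Qex))).toReal
        let n : ℕ := numNodes a b m (C₁ m) D (tol wi ε)
        let L : ℕ := numLevels (levelBias P τ a b Qex Q n) m (C₂ m) C₃ (tol wb ε) n
        let N : ℕ → ℕ := numSamples (levelVar P τ a b Q n) cost m (C₂ m) C₃ (tol ws ε) n L
        mse P' a b (derivOn a b m (paramExp P τ Qex)) (mlmcDeriv τ a b Y n L N m) ≤
            ENNReal.ofReal (ε ^ 2) ∧
        mlmcCost cost L N ≤
            K * (Real.log ε⁻¹ * ε ^ (-2 - 2 * (m : ℝ) / (4 - (m : ℝ))) *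
              rateFactor α β γ m ε) := by
  refine ⟨⟨_, _, _, fun a b hab => isSplineConstants hab⟩, ?_⟩
  intro Ω Ω' _ _ P _ P' _ τ a b _ _ hab C₁ C₂ C₃ hC Qex Q _ _ _ hQ hΦ Y hind hY₀ hY cost hcost
    α β γ hα _ hγ hmin cα cβ cγ hbias hvar hcγ wi wb ws hwi hwb hws hw m hm
  have hC₁ := hC.pos₁ m hm
  have hC₂ := hC.pos₂ m hm
  have hC₃ := hC.pos₃
  obtain ⟨K, hK, H⟩ := exists_mlmcCost_le (bias := fun n => levelBias P τ a b Qex Q n)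
    (V := fun n => levelVar P τ a b Q n)
    (D := (supNorm a b (derivOn a b 4 (paramExp P τ Qex))).toReal) hab hC₁ hC₂ hC₃
    ENNReal.toReal_nonneg hcost hα hγ hmin hbias hvar hcγ hwi hwb hws hm
  refine ⟨K, hK, fun ε hε hε1 => ?_⟩
  intro D n L N
  refine ⟨?_, H ε hε hε1 n L rfl rfl⟩
  have hn : 4 ≤ n := four_le_numNodes _ _ _ _ _ _
  have hn' := natCast_sub_one_pos hn
  have hεs := tol_pos hws hε
  set c := C₂ m * C₃ * ((n : ℝ) - 1) ^ m with hc
  have hc0 : 0 < c := by positivity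
  have hi : C₁ m * ((b - a) / n) ^ (4 - m) * D ≤ tol wi ε :=
    interp_error_numNodes_le hab hC₁ ENNReal.toReal_nonneg (tol_pos hwi hε) hm
  have hi0 : 0 ≤ C₁ m * ((b - a) / n) ^ (4 - m) * D := by
    have := sub_pos.2 hab
    have : 0 ≤ D := ENNReal.toReal_nonneg
    positivity
  have hb : c * levelBias P τ a b Qex Q n L ≤ tol wb ε := by
    have := bias_numLevels_le (m := m) hα hC₂ hC₃ hn (tol_pos hwb hε) (fun l => hbias n l hn)
    rw [le_div_iff₀ hc0] at this
    rw [mul_comm]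
    exact this
  have hV : ∀ l, 0 ≤ levelVar P τ a b Q n l := fun l => integral_nonneg fun ω => sq_nonneg _
  obtain ⟨hmem, hstat⟩ := integral_norm_sq_mlmcPoint_sub_le (L := L) (N := N) hab hn hQ hind hY₀ hY
    (fun l hl hVl => numSamples_ne_zero hn hC₂ hC₃ hεs hcost hl hVl)
  set Z : Ω' → Fin n → ℝ := fun ω j => mlmcPoint τ Y L N (gridNode a b n j) ω -
    paramExp P τ (Q L) (gridNode a b n j) with hZ
  have hs : c ^ 2 * ∫ ω, ‖Z ω‖ ^ 2 ∂P' ≤ tol ws ε ^ 2 := by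
    have h1 := sampleFactor_mul_sum_div_le (m := m) (L := L) (V := levelVar P τ a b Q n) hn hC₂ hC₃
      hεs hcost hV
    have h2 : sampleFactor m (C₂ m) C₃ (tol ws ε) n = c ^ 2 * cConst n / tol ws ε ^ 2 := by
      rw [sampleFactor, hc]
      congr 1
      ring
    rw [h2, div_mul_eq_mul_div, div_le_one (by positivity)] at h1
    refine (mul_le_mul_of_nonneg_left hstat (by positivity)).trans ?_
    rw [← mul_assoc]
    exact h1
  have hpoint : ∀ ω, supNorm a b (fun t => derivOn a b m (paramExp P τ Qex) t -
      mlmcDeriv τ a b Y n L N m ω t) ^ 2 ≤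
      ENNReal.ofReal (3 * (tol wi ε ^ 2 + tol wb ε ^ 2 + c ^ 2 * ‖Z ω‖ ^ 2)) := by
    intro ω
    have h1 := supNorm_sub_derivOn_splineInterp_le hab hC hΦ hn hm
      (fun j => paramExp P τ (Q L) (gridNode a b n j))
      (fun j => mlmcPoint τ Y L N (gridNode a b n j) ω)
    refine (pow_le_pow_left₀ bot_le h1 2).trans ?_
    rw [← ENNReal.ofReal_pow (by positivity)]
    refine ENNReal.ofReal_le_ofReal ?_
    have h2 : C₁ m * ((b - a) / n) ^ (4 - m) * D + c * levelBias P τ a b Qex Q n L + c * ‖Z ω‖ ≤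
        tol wi ε + tol wb ε + c * ‖Z ω‖ := by linarith
    refine (pow_le_pow_left₀ ?_ h2 2).trans ?_
    · have : 0 ≤ levelBias P τ a b Qex Q n L := norm_nonneg _
      positivity
    · nlinarith [sq_nonneg (tol wi ε - tol wb ε), sq_nonneg (tol wi ε - c * ‖Z ω‖),
        sq_nonneg (tol wb ε - c * ‖Z ω‖)]
  have hint : Integrable (fun ω => 3 * (tol wi ε ^ 2 + tol wb ε ^ 2 + c ^ 2 * ‖Z ω‖ ^ 2)) P' :=
    ((integrable_const _).add ((hmem.integrable_norm_pow (by simp)).const_mul _)).const_mul 3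
  calc _ ≤ ∫⁻ ω, ENNReal.ofReal (3 * (tol wi ε ^ 2 + tol wb ε ^ 2 + c ^ 2 * ‖Z ω‖ ^ 2)) ∂P' :=
        lintegral_mono hpoint
    _ = ENNReal.ofReal (∫ ω, 3 * (tol wi ε ^ 2 + tol wb ε ^ 2 + c ^ 2 * ‖Z ω‖ ^ 2) ∂P') :=
        (ofReal_integral_eq_lintegral_ofReal hint (.of_forall fun ω => by positivity)).symm
    _ ≤ _ := by
        refine ENNReal.ofReal_le_ofReal ?_
        rw [integral_const_mul, integral_add (integrable_const _)
          ((hmem.integrable_norm_pow (by simp)).const_mul _), integral_const_mul]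
        simp only [integral_const, probReal_univ, one_smul]
        rw [tol_sq hwi, tol_sq hwb]
        rw [tol_sq hws] at hs
        have : ε ^ 2 = 3 * (wi * ε ^ 2 / 3 + wb * ε ^ 2 / 3 + ws * ε ^ 2 / 3) := by
          linear_combination (-ε ^ 2) * hw
        linarith
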